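/- Let $d, d_{\mathrm{in}} \ge 1$ be integers, let $s>0$, and let $\sigma:\mathbb{R}\to\mathbb{R}$ be a Lipschitz continuous activation function, applied componentwise. Let $\mathbb{T}^d=(\mathbb{R}/\mathbb{Z})^d$ with its normalised Lebesgue measure, and let $$\mathcal{K}=\Big\{u\in L^2(\mathbb{T}^d;\mathbb{R}^{d_{\mathrm{in}}}) : \|u\|_{H^s}^2=\sum_{k\in\mathbb{Z}^d}(1+|2\pi k|^2)^s\,|\hat u(k)|^2\le 1\Big\}$$ be the unit ball of $H^s(\mathbb{T}^d;\mathbb{R}^{d_{\mathrm{in}}})$, equipped with the $L^2$-metric. Let $\mathrm{Lip}_1(\mathcal{K})$ be the set of all $\mathcal{G}:\mathcal{K}\to\mathbb{R}$ with $\sup_{\mathcal{K}}|\mathcal{G}|\le 1$ and $|\mathcal{G}(u)-\mathcal{G}(v)|\le\|u-v\|_{L^2}$ for all $u,v\in\mathcal{K}$, with the topology of the supremum norm. An output-averaged Fourier neural operator (FNO) of channel width $d_c$, Fourier cut-off $\kappa$ and depth $L$ is a map $$\Phi(u;\theta)=\int_{\mathbb{T}^d} Q\,\big(\mathcal{L}_L\circ\dots\circ\mathcal{L}_1\big)(Pu)(x)\,dx,\qquad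 \mathcal{L}_\ell(v)(x)=\sigma\big(W^{(\ell)}v(x)+(K^{(\ell)}v)(x)+b^{(\ell)}\big),$$ $$(K^{(\ell)}v)(x)=\mathrm{Re}\sum_{k\in\mathbb{Z}^d,\,|k|_{\ell^\infty}<\kappa}\hat P^{(\ell)}_k\,\hat v(k)\,e^{2\pi i k\cdot x},$$ where $(Pu)(x)=P\,u(x)$ and the parameters $\theta$ consist of the matrices and vectors $P\in\mathbb{R}^{d_c\times d_{\mathrm{in}}}$, $W^{(\ell)}\in\mathbb{R}^{d_c\times d_c}$, $\hat P^{(\ell)}_k\in\mathbb{C}^{d_c\times d_c}$, $b^{(\ell)}\in\mathbb{R}^{d_c}$, $Q\in\mathbb{R}^{1\times d_c}$. Its number of tunable parameters is the number of their entries, $d_cd_{\mathrm{in}}+L\big(d_c^2+N_\kappa d_c^2+d_c\big)+d_c$, where $N_\kappa$ is the number of $k\in\mathbb{Z}^d$ with $|k|_{\ell^\infty}<\kappa$ (so $N_\kappa=(2\kappa-1)^d$ for $\kappa\ge1$), and $\|\theta\|_{\ell^\infty}$ is the largest absolute value of the real entries and of the real and imaginary parts of the complex entries. For $\gamma>0$,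 we say that $\mathcal{G}:\mathcal{K}\to\mathbb{R}$ can be approximated by FNO at logarithmic rate $\gamma$ if there are output-averaged FNOs $\Phi_q(\cdot\,;\theta_q)$, $q\in\mathbb{N}$, with activation $\sigma$ and of arbitrary widths, cut-offs and depths, such that, for all sufficiently large $q$, $\Phi_q$ has at most $q$ tunable parameters and $\|\theta_q\|_{\ell^\infty}\le\exp(q)$, and $$\sup_{u\in\mathcal{K}}|\mathcal{G}(u)-\Phi_q(u;\theta_q)|=O\big(\log(q)^{-\gamma}\big)\qquad(q\to\infty).$$ Then generic $\mathcal{G}\in\mathrm{Lip}_1(\mathcal{K})$ cannot be approximated by FNO at logarithmic rate $\gamma$ for any $\gamma>s/d$; that is, the set of all $\mathcal{G}\in\mathrm{Lip}_1(\mathcal{K})$ for which there is no $\gamma>s/d$ such that $\mathcal{G}$ can be approximated by FNO at logarithmic rate $\gamma$ is residual in $\mathrm{Lip}_1(\mathcal{K})$ (it contains a countable intersection of dense open subsets). -/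

import Mathlib

open MeasureTheory Filter Topology
open scoped NNReal ENNReal Matrix BoundedContinuousFunction

noncomputable section

namespace FNO

/-- The normalised Haar (Lebesgue) measure on the `1`-periodic torus `𝕋ᵈ = (ℝ/ℤ)ᵈ`; it is the
measure with respect to which Mathlib's `UnitAddTorus.mFourierCoeff` is computed. -/
abbrev torusMeasure (d : ℕ) : Measure (UnitAddTorus (Fin d)) :=
  Measure.pi fun _ => AddCircle.haarAddCircle

instance (d : ℕ) : IsProbabilityMeasure (torusMeasure d) := by
  unfold torusMeasure; infer_instance

/-- `L²(𝕋ᵈ; ℝ^dIn)`. -/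
abbrev L2 (d dIn : ℕ) : Type := Lp (EuclideanSpace ℝ (Fin dIn)) 2 (torusMeasure d)

/-- The `k`-th Fourier coefficient `∫ f(x) exp(-2πi k·x) dx` of a real-valued function on `𝕋ᵈ`. -/
def fcoeff {d : ℕ} (f : UnitAddTorus (Fin d) → ℝ) (k : Fin d → ℤ) : ℂ :=
  UnitAddTorus.mFourierCoeff (fun x => (f x : ℂ)) k

/-! ### The Sobolev unit ball -/

/-- The Sobolev norm
`‖u‖_{H^s} = (∑_{k ∈ ℤᵈ} (1 + |2πk|²)^s |û(k)|²)^{1/2} ∈ [0, ∞]` of `u ∈ L²(𝕋ᵈ; ℝ^dIn)`;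
the space `H^s` consists of the `u` for which it is finite (`s ≥ 0`). -/
def sobolevNorm {d dIn : ℕ} (s : ℝ) (u : L2 d dIn) : ℝ≥0∞ :=
  (∑' k : Fin d → ℤ, ENNReal.ofReal
    ((1 + ∑ i, (2 * Real.pi * (k i : ℝ)) ^ 2) ^ s * ∑ j, ‖fcoeff (fun x => u x j) k‖ ^ 2))
      ^ (1 / 2 : ℝ)

/-- The unit ball of `H^s(𝕋ᵈ; ℝ^dIn)`, as a subset of (and with the metric of)
`L²(𝕋ᵈ; ℝ^dIn)`. -/
def sobolevBall (d dIn : ℕ) (s : ℝ) : Set (L2 d dIn) :=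
  {u | sobolevNorm s u ≤ 1}

/-! ### The class of 1-Lipschitz operators -/

/-- `Lip₁(D)`: functions `G : D → ℝ` with `sup |G| ≤ 1` and Lipschitz constant at most `1`, as a
subset of the bounded continuous functions with the supremum norm. -/
def Lip1 (D : Type*) [PseudoMetricSpace D] : Set (D →ᵇ ℝ) :=
  {G | (∀ u, |G u| ≤ 1) ∧ LipschitzWith 1 G}

/-! ### Output-averaged Fourier neural operators -/

/-- The wavenumbers `k ∈ ℤᵈ` with `|k|_∞ < κ`. -/
def modes (d κ : ℕ) : Finset (Fin d → ℤ) :=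
  Fintype.piFinset fun _ => Finset.Ioo (-(κ : ℤ)) (κ : ℤ)

lemma mem_modes {d κ : ℕ} {k : Fin d → ℤ} : k ∈ modes d κ ↔ ∀ i, |k i| < (κ : ℤ) := by
  simp [modes, abs_lt]

lemma card_modes (d κ : ℕ) : (modes d κ).card = (2 * κ - 1) ^ d := by
  simp only [modes, Fintype.card_piFinset, Int.card_Ioo, Finset.prod_const, Finset.card_univ,
    Fintype.card_fin]
  congr 1
  omega

/-- The parameters of a hidden layer of channel width `dc` and Fourier cut-off `κ`: the matrix
`W`, the Fourier multiplier `P̂ = (P̂_k)_{|k|_∞ < κ}`, and the bias `b`. -/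
structure Layer (d dc κ : ℕ) where
  W : Matrix (Fin dc) (Fin dc) ℝ
  mult : modes d κ → Matrix (Fin dc) (Fin dc) ℂ
  b : Fin dc → ℝ

/-- The non-local operator `K v = 𝓕⁻¹ (P̂_k (𝓕 v)(k))`. The real part makes the output
real-valued; it has no effect when `P̂_{-k}` is the complex conjugate of `P̂_k`. -/
def Layer.nonlocal {d dc κ : ℕ} (ℓ : Layer d dc κ) (v : UnitAddTorus (Fin d) → Fin dc → ℝ)
    (x : UnitAddTorus (Fin d)) (i : Fin dc) : ℝ :=
  (∑ k : modes d κ, (∑ j, ℓ.mult k i j * fcoeff (fun y => v y j) k) *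
    UnitAddTorus.mFourier (k : Fin d → ℤ) x).re

/-- The hidden layer `v ↦ σ(W v(x) + (K v)(x) + b)`, `σ` acting componentwise. -/
def Layer.apply {d dc κ : ℕ} (σ : ℝ → ℝ) (ℓ : Layer d dc κ)
    (v : UnitAddTorus (Fin d) → Fin dc → ℝ) : UnitAddTorus (Fin d) → Fin dc → ℝ :=
  fun x i => σ ((ℓ.W *ᵥ v x) i + ℓ.nonlocal v x i + ℓ.b i)

/-- The architecture (channel width `dc`, cut-off `κ`, depth `layers.length`) of an
output-averaged FNO on `𝕋ᵈ` with `dIn` input components, together with its parameters: the lifting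
matrix `P`, the hidden layers (the first one applied first), and the row vector `Q` of the linear
projection to a scalar. -/
structure Network (d dIn : ℕ) where
  dc : ℕ
  κ : ℕ
  P : Matrix (Fin dc) (Fin dIn) ℝ
  layers : List (Layer d dc κ)
  Q : Fin dc → ℝ

/-- The last hidden state `(𝓛_L ∘ ⋯ ∘ 𝓛_1 ∘ P)(u)`. -/
def Network.hidden {d dIn : ℕ} (σ : ℝ → ℝ) (Φ : Network d dIn) (u : L2 d dIn) :
    UnitAddTorus (Fin d) → Fin Φ.dc → ℝ :=
  Φ.layers.foldl (fun v ℓ => ℓ.apply σ v) (fun x => Φ.P *ᵥ fun j => u x j)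

/-- The output `Φ(u) = ∫_{𝕋ᵈ} (Q ∘ 𝓛_L ∘ ⋯ ∘ 𝓛_1 ∘ P)(u)(x) dx`, with activation `σ`. -/
def Network.eval {d dIn : ℕ} (σ : ℝ → ℝ) (Φ : Network d dIn) (u : L2 d dIn) : ℝ :=
  ∫ x, Φ.Q ⬝ᵥ Φ.hidden σ u x ∂(torusMeasure d)

/-- The number of tunable parameters: the entries of `P`, of `W`, `P̂` and `b` in every layer, and
of `Q`. An entry of the multiplier counts once: the multipliers with `P̂_{-k}` conjugate to `P̂_k`
have exactly that many real degrees of freedom. -/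
def Network.numParams {d dIn : ℕ} (Φ : Network d dIn) : ℕ :=
  Φ.dc * dIn + Φ.layers.length * (Φ.dc ^ 2 + (modes d Φ.κ).card * Φ.dc ^ 2 + Φ.dc) + Φ.dc

/-- `‖θ‖_{ℓ^∞} ≤ M`, for the vector `θ` of all (real) parameters of the network; a complex number
has its real and imaginary parts as real parameters. -/
def Network.ParamsLE {d dIn : ℕ} (Φ : Network d dIn) (M : ℝ) : Prop :=
  (∀ i j, |Φ.P i j| ≤ M) ∧
  (∀ ℓ ∈ Φ.layers, (∀ i j, |ℓ.W i j| ≤ M) ∧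
    (∀ k i j, |(ℓ.mult k i j).re| ≤ M ∧ |(ℓ.mult k i j).im| ≤ M) ∧ ∀ i, |ℓ.b i| ≤ M) ∧
  ∀ i, |Φ.Q i| ≤ M

/-- `G : K → ℝ` can be approximated by FNO with activation `σ` at logarithmic rate `γ`: there is a
sequence of output-averaged FNOs `Φ_q` such that, for large `q`, `Φ_q` has at most `q` parameters,
bounded by `exp q`, and `sup_{u ∈ K} |G(u) - Φ_q(u)| ≤ C (log q)^{-γ}`. -/
def ApproxAtLogRate {d dIn : ℕ} (σ : ℝ → ℝ) {K : Set (L2 d dIn)} (G : K → ℝ) (γ : ℝ) : Prop :=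
  ∃ (Φ : ℕ → Network d dIn) (C : ℝ), ∀ᶠ q : ℕ in atTop,
    (Φ q).numParams ≤ q ∧ (Φ q).ParamsLE (Real.exp q) ∧
      ∀ u : K, |G u - (Φ q).eval σ u| ≤ C * (Real.log q) ^ (-γ)

end FNO

end

/-!
The proof compares metric entropies and concludes by Baire category.

Networks with at most `q` parameters, all bounded by `exp q`, form a small family. The output of a
network of given architecture is Lipschitz in the parameters, uniformly over the unit ball of
`L²(𝕋ᵈ)`, with a constant of order `exp (C q²)` (`abs_eval_sub_eval_le`). This is shown in the
`L¹` norm of the hidden states: it bounds every Fourier coefficient, hence the non-local operators,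
and one layer multiplies both the state and its perturbation by at most a factor `growth`. A grid
of mesh `exp (-q⁴)` in parameter space has far fewer than `2 ^ (q ^ 8)` cells, over all
architectures together, so among that many networks two agree up to `exp (-q)`
(`eventually_exists_ne_abs_eval_sub_le`).

The class `Lip₁` is large. The trigonometric polynomials with frequencies in `{1, …, N}ᵈ` form a
space of dimension `N ^ d` on which the `H^s` norm is at most a multiple of `N ^ s` times the `L²`
norm. A volume argument in that space gives `M = 2 ^ (N ^ d)` points of the Sobolev ball at mutual
distance at least `c N ^ (-s)` (`exists_packing_sobolevBall`). The truncated distance functions to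
the nonempty subsets of these points are `2 ^ M - 1` elements of `Lip₁` with the same mutual
distance (`exists_separated_family_Lip1`). As `Lip₁` is convex, a scaled copy of this family lies in
every ball of `Lip₁`.

Let `q = 2 ^ (p ^ d)` and `N = 8 p`, so that `M ≥ q ^ 8`. If the operators approximated at rate
`γ > s / d`, with fixed constants, were dense in some ball, two members of the family in that ball
would be approximated by nearly equal networks, hence be at distance
`O((log q) ^ (-γ)) = O(p ^ (-d γ))`. This is `o(p ^ (-s))`, a contradiction. So each of these sets
is nowhere dense (`isNowhereDense_approxSet`), and countably many of them cover all operators that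
can be approximated at some rate `γ > s / d`.
-/

noncomputable section

namespace FNO

/-! ### Fourier coefficients and the Sobolev ball -/

lemma hasSum_sq_fcoeff {d : ℕ} {f : UnitAddTorus (Fin d) → ℝ} (hf : MemLp f 2 (torusMeasure d)) :
    HasSum (fun k => ‖fcoeff f k‖ ^ 2) (∫ x, f x ^ 2 ∂torusMeasure d) := by
  have hg : MemLp (fun x => (f x : ℂ)) 2 (torusMeasure d) := hf.ofReal
  have h := UnitAddTorus.hasSum_sq_mFourierCoeff (d := Fin d) (hg.toLp _)
  have hc : ∀ k, UnitAddTorus.mFourierCoeff (hg.toLp _) k = fcoeff f k := fun k =>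
    integral_congr_ae (ae_eq_rfl.mul hg.coeFn_toLp)
  have hi : ∫ x, ‖hg.toLp _ x‖ ^ 2 ∂torusMeasure d = ∫ x, f x ^ 2 ∂torusMeasure d := by
    apply integral_congr_ae
    filter_upwards [hg.coeFn_toLp] with x hx
    rw [hx]; simp
  simp only [hc] at h
  rw [← hi]
  exact h

lemma memLp_component {d dIn : ℕ} (u : L2 d dIn) (j : Fin dIn) :
    MemLp (fun x => u x j) 2 (torusMeasure d) :=
  (Lp.memLp u).eval_piLp j

lemma integrable_component {d dIn : ℕ} (u : L2 d dIn) (j : Fin dIn) :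
    Integrable (fun x => u x j) (torusMeasure d) :=
  (memLp_component u j).integrable (by norm_num)

lemma norm_sq_eq_sum_integral {d dIn : ℕ} (u : L2 d dIn) :
    ‖u‖ ^ 2 = ∑ j, ∫ x, u x j ^ 2 ∂torusMeasure d := by
  rw [← real_inner_self_eq_norm_sq, L2.inner_def, ← integral_finsetSum]
  · refine integral_congr_ae (Eventually.of_forall fun x => ?_)
    simp [EuclideanSpace.norm_sq_eq]
  · exact fun j _ => (memLp_component u j).integrable_sq

/-- Parseval's identity in `L²(𝕋ᵈ; ℝ^dIn)`. -/
lemma hasSum_sq_fcoeff_L2 {d dIn : ℕ} (u : L2 d dIn) :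
    HasSum (fun k => ∑ j, ‖fcoeff (fun x => u x j) k‖ ^ 2) (‖u‖ ^ 2) := by
  rw [norm_sq_eq_sum_integral]
  exact hasSum_sum fun j _ => hasSum_sq_fcoeff (memLp_component u j)

lemma tsum_ofReal_sq_fcoeff {d dIn : ℕ} (u : L2 d dIn) :
    ∑' k, ENNReal.ofReal (∑ j, ‖fcoeff (fun x => u x j) k‖ ^ 2) = ENNReal.ofReal (‖u‖ ^ 2) := by
  rw [← (hasSum_sq_fcoeff_L2 u).tsum_eq, ENNReal.ofReal_tsum_of_nonneg]
  · intro k; positivity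
  · exact (hasSum_sq_fcoeff_L2 u).summable

lemma sobolevNorm_le_one_iff {d dIn : ℕ} {s : ℝ} {u : L2 d dIn} :
    sobolevNorm s u ≤ 1 ↔ ∑' k : Fin d → ℤ, ENNReal.ofReal
      ((1 + ∑ i, (2 * Real.pi * (k i : ℝ)) ^ 2) ^ s *
        ∑ j, ‖fcoeff (fun x => u x j) k‖ ^ 2) ≤ 1 := by
  rw [sobolevNorm]
  constructor
  · intro h
    have := ENNReal.rpow_le_rpow h (zero_le_two : (0 : ℝ) ≤ 2)
    rwa [← ENNReal.rpow_mul, ENNReal.one_rpow, one_div, inv_mul_cancel₀ two_ne_zero,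
      ENNReal.rpow_one] at this
  · intro h
    exact ENNReal.rpow_le_one h (by norm_num)

lemma norm_le_one_of_mem_sobolevBall {d dIn : ℕ} {s : ℝ} (hs : 0 ≤ s) {u : L2 d dIn}
    (hu : u ∈ sobolevBall d dIn s) : ‖u‖ ≤ 1 := by
  have h := sobolevNorm_le_one_iff.1 hu
  have h' : ENNReal.ofReal (‖u‖ ^ 2) ≤ 1 := by
    rw [← tsum_ofReal_sq_fcoeff]
    refine (ENNReal.tsum_le_tsum fun k => ?_).trans h
    apply ENNReal.ofReal_le_ofReal
    refine le_mul_of_one_le_left (by positivity) (Real.one_le_rpow ?_ hs)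
    have : 0 ≤ ∑ i, (2 * Real.pi * (k i : ℝ)) ^ 2 := by positivity
    linarith
  rw [ENNReal.ofReal_le_one] at h'
  nlinarith [norm_nonneg u]

/-- Since `|t| ≤ (1 + t²) / 2`, the unit ball of `L²` is bounded in `L¹`. -/
lemma integral_abs_component_le_one {d dIn : ℕ} {u : L2 d dIn} (hu : ‖u‖ ≤ 1) (j : Fin dIn) :
    ∫ x, |u x j| ∂torusMeasure d ≤ 1 := by
  have h1 : ∫ x, u x j ^ 2 ∂torusMeasure d ≤ 1 := by
    calc ∫ x, u x j ^ 2 ∂torusMeasure d ≤ ∑ j, ∫ x, u x j ^ 2 ∂torusMeasure d :=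
          Finset.single_le_sum (f := fun j => ∫ x, u x j ^ 2 ∂torusMeasure d)
            (fun j _ => integral_nonneg fun x => sq_nonneg _) (Finset.mem_univ j)
      _ = ‖u‖ ^ 2 := (norm_sq_eq_sum_integral u).symm
      _ ≤ 1 := pow_le_one₀ (norm_nonneg _) hu
  have h2 : ∫ x, |u x j| ∂torusMeasure d ≤ ∫ x, (1 + u x j ^ 2) / 2 ∂torusMeasure d := by
    apply integral_mono (integrable_component u j).abs
    · exact (((integrable_const 1).add (memLp_component u j).integrable_sq).div_const 2)
    · intro x
      have := sq_nonneg (|u x j| - 1)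
      simp only
      nlinarith [sq_abs (u x j)]
  rw [integral_div, integral_add (integrable_const 1) (memLp_component u j).integrable_sq] at h2
  simp at h2
  linarith

/-- If the Sobolev weight is at most `W` on the support of `û`, then `‖u‖_{H^s}² ≤ W ‖u‖²`. -/
lemma mem_sobolevBall_of_fcoeff_eq_zero {d dIn : ℕ} {s W : ℝ} {u : L2 d dIn}
    (hW : ∀ k : Fin d → ℤ, (1 + ∑ i, (2 * Real.pi * (k i : ℝ)) ^ 2) ^ s ≤ W ∨
      ∀ j, fcoeff (fun x => u x j) k = 0) (hW0 : 0 ≤ W)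
    (hu : W * ‖u‖ ^ 2 ≤ 1) : u ∈ sobolevBall d dIn s := by
  refine sobolevNorm_le_one_iff.2 ?_
  calc _ ≤ ∑' k : Fin d → ℤ, ENNReal.ofReal W *
        ENNReal.ofReal (∑ j, ‖fcoeff (fun x => u x j) k‖ ^ 2) := by
        refine ENNReal.tsum_le_tsum fun k => ?_
        rw [← ENNReal.ofReal_mul hW0]
        apply ENNReal.ofReal_le_ofReal
        rcases hW k with h | h
        · exact mul_le_mul_of_nonneg_right h (by positivity)
        · simp [h]
    _ = ENNReal.ofReal (W * ‖u‖ ^ 2) := by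
        rw [ENNReal.tsum_mul_left, tsum_ofReal_sq_fcoeff, ENNReal.ofReal_mul hW0]
    _ ≤ 1 := ENNReal.ofReal_le_one.2 hu

/-! ### Trigonometric polynomials in the Sobolev ball -/

lemma norm_mFourier_apply {d : ℕ} (k : Fin d → ℤ) (x : UnitAddTorus (Fin d)) :
    ‖UnitAddTorus.mFourier k x‖ = 1 := by
  simp only [UnitAddTorus.mFourier, ContinuousMap.coe_mk, norm_prod, fourier_apply,
    Circle.norm_coe, Finset.prod_const_one]

lemma integrable_mFourier_smul_ofReal {d : ℕ} {f : UnitAddTorus (Fin d) → ℝ}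
    (hf : Integrable f (torusMeasure d)) (k : Fin d → ℤ) :
    Integrable (fun x => UnitAddTorus.mFourier k x • (f x : ℂ)) (torusMeasure d) :=
  hf.ofReal.bdd_mul (c := 1) (UnitAddTorus.mFourier k).continuous.aestronglyMeasurable
    (Eventually.of_forall fun x => (norm_mFourier_apply k x).le)

/-- The Fourier coefficient of one component, as a linear functional on `L²`. -/
def fcoeffL {d dIn : ℕ} (j : Fin dIn) (k : Fin d → ℤ) : L2 d dIn →ₗ[ℝ] ℂ where
  toFun u := fcoeff (fun x => u x j) k
  map_add' u v := by
    refine Eq.trans ?_ (integral_add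
      (integrable_mFourier_smul_ofReal (integrable_component u j) (-k))
      (integrable_mFourier_smul_ofReal (integrable_component v j) (-k)))
    refine integral_congr_ae ?_
    filter_upwards [Lp.coeFn_add u v] with x hx
    simp only [hx, Pi.add_apply, PiLp.add_apply, Complex.ofReal_add, smul_add]
  map_smul' c u := by
    refine Eq.trans ?_ (integral_const_mul (c : ℂ) _)
    refine integral_congr_ae ?_
    filter_upwards [Lp.coeFn_smul c u] with x hx
    simp [hx]
    ring

/-- The field `x ↦ cos(2π k·x) e_j`. -/
def cosMode {d dIn : ℕ} (j : Fin dIn) (k : Fin d → ℤ) : L2 d dIn :=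
  ContinuousMap.toLp (E := EuclideanSpace ℝ (Fin dIn)) 2 (torusMeasure d) ℝ
    ⟨fun x => (UnitAddTorus.mFourier k x).re • EuclideanSpace.single j 1, by fun_prop⟩

lemma mFourierCoeff_mFourier {d : ℕ} (k l : Fin d → ℤ) :
    UnitAddTorus.mFourierCoeff (UnitAddTorus.mFourier k) l = if l = k then 1 else 0 := by
  rw [← UnitAddTorus.mFourierCoeff_toLp, ← UnitAddTorus.mFourierBasis_repr,
    HilbertBasis.repr_apply_apply, UnitAddTorus.coe_mFourierBasis]
  exact orthonormal_iff_ite.1 UnitAddTorus.orthonormal_mFourier l k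

lemma integrable_mFourier_smul_mFourier {d : ℕ} (k l : Fin d → ℤ) :
    Integrable (fun x => UnitAddTorus.mFourier l x • UnitAddTorus.mFourier k x)
      (torusMeasure d) :=
  (BoundedContinuousFunction.mkOfCompact
    (UnitAddTorus.mFourier l * UnitAddTorus.mFourier k)).integrable _

lemma fcoeffL_cosMode {d dIn : ℕ} (i j : Fin dIn) (k l : Fin d → ℤ) :
    fcoeffL i l (cosMode j k) =
      if i = j then ((if l = k then 1 else 0) + (if l = -k then 1 else 0)) / 2 else 0 := by
  have h : fcoeffL i l (cosMode j k) = ∫ x, UnitAddTorus.mFourier (-l) x •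
      ((((UnitAddTorus.mFourier k x).re • EuclideanSpace.single j 1 :
        EuclideanSpace ℝ (Fin dIn)) i : ℝ) : ℂ) ∂torusMeasure d := by
    refine integral_congr_ae ?_
    filter_upwards [ContinuousMap.coeFn_toLp (E := EuclideanSpace ℝ (Fin dIn)) (p := 2)
      (𝕜 := ℝ) (torusMeasure d)
      ⟨fun x => (UnitAddTorus.mFourier k x).re • EuclideanSpace.single j 1,
        by fun_prop⟩] with x hx
    simp only [cosMode, hx]; rfl
  rw [h]
  by_cases hij : i = j
  · rw [if_pos hij]
    rw [← mFourierCoeff_mFourier, ← mFourierCoeff_mFourier]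
    refine Eq.trans ?_ (congrArg (· / 2) (integral_add (integrable_mFourier_smul_mFourier k (-l))
      (integrable_mFourier_smul_mFourier (-k) (-l))))
    refine Eq.trans (integral_congr_ae (Eventually.of_forall fun x => ?_)) (integral_div (2 : ℂ) _)
    simp [hij, UnitAddTorus.mFourier_neg, Complex.re_eq_add_conj]
    ring
  · rw [if_neg hij]
    simp [hij]

/-- The space of trigonometric polynomials spanned by the fields `cos(2π k·x) e_j` with
`k ∈ {1, …, N}ᵈ`. -/
def cosSpan {d dIn : ℕ} (j : Fin dIn) (N : ℕ) : Submodule ℝ (L2 d dIn) :=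
  Submodule.span ℝ (Set.range fun κ : Fin d → Fin N => cosMode j fun i => ((κ i : ℕ) : ℤ) + 1)

instance {d dIn : ℕ} (j : Fin dIn) (N : ℕ) :
    FiniteDimensional ℝ (cosSpan (d := d) j N) :=
  FiniteDimensional.span_of_finite ℝ (Set.finite_range _)

lemma finrank_cosSpan {d dIn : ℕ} (hd : 1 ≤ d) (j : Fin dIn) (N : ℕ) :
    Module.finrank ℝ (cosSpan (d := d) j N) = N ^ d := by
  rw [cosSpan, finrank_span_eq_card]
  · simp
  rw [Fintype.linearIndependent_iff]
  intro g hg κ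
  have h := congrArg (fcoeffL j fun i => ((κ i : ℕ) : ℤ) + 1) hg
  have h1 : ∀ κ' : Fin d → Fin N,
      (fun i => ((κ i : ℕ) : ℤ) + 1) = (fun i => ((κ' i : ℕ) : ℤ) + 1) ↔ κ = κ' := fun κ' => by
    simp [funext_iff, Fin.ext_iff]
  -- The frequency `-k'` has negative entries, so it is never one of those in `{1, …, N}ᵈ`.
  have h2 : ∀ κ' : Fin d → Fin N,
      ¬ (fun i => ((κ i : ℕ) : ℤ) + 1) = -(fun i => ((κ' i : ℕ) : ℤ) + 1) := fun κ' h => by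
    have := congrFun h ⟨0, hd⟩
    simp only [Pi.neg_apply] at this
    omega
  simp only [map_sum, map_smul, fcoeffL_cosMode, h1, h2, if_true, if_false, map_zero] at h
  simpa [ite_div] using h

lemma fcoeffL_eq_zero_of_mem_cosSpan {d dIn : ℕ} {i j : Fin dIn} {N : ℕ} {k : Fin d → ℤ}
    (hk : ¬ ∀ i, |k i| ≤ (N : ℤ)) {u : L2 d dIn} (hu : u ∈ cosSpan j N) :
    fcoeffL i k u = 0 := by
  suffices h : cosSpan j N ≤ LinearMap.ker (fcoeffL i k) from h hu
  refine Submodule.span_le.2 ?_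
  rintro _ ⟨κ, rfl⟩
  have hκ : ∀ i, |((κ i : ℕ) : ℤ) + 1| ≤ (N : ℤ) := fun i => by
    rw [abs_of_nonneg (by positivity)]
    have := (κ i).2
    omega
  have h1 : k ≠ fun i => ((κ i : ℕ) : ℤ) + 1 := by
    rintro rfl
    exact hk hκ
  have h2 : k ≠ -fun i => ((κ i : ℕ) : ℤ) + 1 := by
    rintro rfl
    exact hk fun i => (abs_neg _).trans_le (hκ i)
  simp [fcoeffL_cosMode, h1, h2]

lemma mem_sobolevBall_of_mem_cosSpan {d dIn : ℕ} {s : ℝ} (hs : 0 ≤ s) {j : Fin dIn} {N : ℕ}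
    {u : L2 d dIn} (hu : u ∈ cosSpan j N)
    (h : (1 + d * (2 * Real.pi * N) ^ 2) ^ s * ‖u‖ ^ 2 ≤ 1) : u ∈ sobolevBall d dIn s := by
  refine mem_sobolevBall_of_fcoeff_eq_zero (fun k => ?_) (by positivity) h
  by_cases hk : ∀ i, |k i| ≤ (N : ℤ)
  · left
    refine Real.rpow_le_rpow (by positivity) ?_ hs
    gcongr
    calc ∑ i, (2 * Real.pi * (k i : ℝ)) ^ 2 ≤ ∑ _i : Fin d, (2 * Real.pi * (N : ℝ)) ^ 2 := by
          refine Finset.sum_le_sum fun i _ => ?_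
          rw [mul_pow, mul_pow _ (N : ℝ)]
          gcongr ?_ * ?_
          refine sq_le_sq' ?_ ?_
          · exact_mod_cast (abs_le.1 (hk i)).1
          · exact_mod_cast (abs_le.1 (hk i)).2
      _ = d * (2 * Real.pi * N) ^ 2 := by simp
  · exact Or.inr fun i => fcoeffL_eq_zero_of_mem_cosSpan hk hu

/-! ### Packing the Sobolev ball -/

/-- A volume bound: fewer than `2 ^ dim E` balls of radius `1/2` do not cover the unit ball, so
separated points can be added one at a time. -/
lemma exists_separated_finset {E : Type*} [NormedAddCommGroup E] [NormedSpace ℝ E]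
    [FiniteDimensional ℝ E] (m : ℕ) (hm : m ≤ 2 ^ Module.finrank ℝ E) :
    ∃ t : Finset E, t.card = m ∧ (∀ x ∈ t, ‖x‖ ≤ 1) ∧
      ∀ x ∈ t, ∀ y ∈ t, x ≠ y → 1 / 2 ≤ dist x y := by
  classical
  induction m with
  | zero => exact ⟨∅, by simp⟩
  | succ m ih =>
    obtain ⟨t, ht, hb, hs⟩ := ih (by omega)
    suffices h : ∃ y : E, ‖y‖ ≤ 1 ∧ ∀ x ∈ t, 1 / 2 ≤ dist y x by
      obtain ⟨y, hy, hyt⟩ := h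
      have hyn : y ∉ t := fun h => by
        have := hyt y h
        norm_num at this
      refine ⟨insert y t, by rw [Finset.card_insert_of_notMem hyn, ht], ?_, ?_⟩
      · simpa [hy] using hb
      · simp only [Finset.mem_insert]
        rintro x (rfl | hx) z (rfl | hz) hxz
        · exact absurd rfl hxz
        · exact hyt z hz
        · rw [dist_comm]; exact hyt x hx
        · exact hs x hx z hz hxz
    by_contra! hcon
    let _ : MeasurableSpace E := borel E
    have : BorelSpace E := ⟨rfl⟩
    let μ : Measure E := Measure.addHaar
    have hcover : Metric.ball (0 : E) 1 ⊆ ⋃ x ∈ t, Metric.ball x (1 / 2) := fun y hy => by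
      obtain ⟨x, hx, hxy⟩ := hcon y (mem_ball_zero_iff.1 hy).le
      exact Set.mem_biUnion hx hxy
    have h0 : μ (Metric.ball (0 : E) 1) ≠ 0 := (Metric.measure_ball_pos μ _ one_pos).ne'
    have h1 : μ (Metric.ball (0 : E) 1) ≠ ∞ := measure_ball_lt_top.ne
    have h := (measure_mono (μ := μ) hcover).trans (measure_biUnion_finset_le t _)
    simp only [Measure.addHaar_ball_of_pos μ _ (show (0 : ℝ) < 1 / 2 by norm_num),
      Finset.sum_const, ht, nsmul_eq_mul] at h
    rw [← mul_assoc] at h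
    have h2 : (1 : ℝ≥0∞) ≤ m * ENNReal.ofReal ((1 / 2) ^ Module.finrank ℝ E) := by
      by_contra! hlt
      exact absurd h (not_le.2 (by simpa using ENNReal.mul_lt_mul_left h0 h1 hlt))
    rw [← ENNReal.ofReal_natCast, ← ENNReal.ofReal_mul (by positivity),
      ENNReal.one_le_ofReal, one_div, inv_pow, ← div_eq_mul_inv, one_le_div (by positivity)] at h2
    have h3 : 2 ^ Module.finrank ℝ E ≤ m := by exact_mod_cast h2
    omega

/-- The `H^s` ball contains `2 ^ (N ^ d)` points at mutual `L²` distance at least a multiple of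
`N ^ (-s)`. -/
lemma exists_packing_sobolevBall {d dIn : ℕ} (hd : 1 ≤ d) (hdIn : 1 ≤ dIn) {s : ℝ} (hs : 0 ≤ s) :
    ∃ c : ℝ, 0 < c ∧ c ≤ 1 ∧ ∀ N : ℕ, 1 ≤ N → ∃ x : Fin (2 ^ N ^ d) → sobolevBall d dIn s,
      ∀ i j, i ≠ j → c * (N : ℝ) ^ (-s) ≤ dist (x i) (x j) := by
  set C : ℝ := 1 + d * (2 * Real.pi) ^ 2 with hC
  have hC1 : 1 ≤ C := by rw [hC]; linarith [show 0 ≤ d * (2 * Real.pi) ^ 2 by positivity]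
  have hC0 : 0 < C := one_pos.trans_le hC1
  refine ⟨C ^ (-s / 2) / 2, by positivity, ?_, fun N hN => ?_⟩
  · linarith [Real.rpow_le_one_of_one_le_of_nonpos hC1 (show -s / 2 ≤ 0 by linarith)]
  have hN1 : (1 : ℝ) ≤ N := by exact_mod_cast hN
  have hN0 : (0 : ℝ) < N := one_pos.trans_le hN1
  set r : ℝ := C ^ (-s / 2) * (N : ℝ) ^ (-s) with hr
  have hr0 : 0 < r := by positivity
  have hW : (1 + d * (2 * Real.pi * N) ^ 2) ^ s * r ^ 2 ≤ 1 := by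
    have h1 : (1 + d * (2 * Real.pi * N) ^ 2) ^ s ≤ (C * (N : ℝ) ^ 2) ^ s := by
      refine Real.rpow_le_rpow (by positivity) ?_ hs
      rw [hC]
      nlinarith
    have h2 : (C * (N : ℝ) ^ 2) ^ s * r ^ 2 = 1 := by
      rw [hr, mul_pow, ← Real.rpow_natCast (C ^ _), ← Real.rpow_natCast ((N : ℝ) ^ (-s)),
        Real.mul_rpow hC0.le (by positivity), ← Real.rpow_natCast (N : ℝ) 2, ← Real.rpow_mul hC0.le,
        ← Real.rpow_mul hN0.le, ← Real.rpow_mul hN0.le]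
      rw [mul_mul_mul_comm, ← Real.rpow_add hC0, ← Real.rpow_add hN0]
      norm_num
      rw [show (2 : ℝ) * s + -(s * 2) = 0 by ring, Real.rpow_zero]
    refine le_trans ?_ h2.le
    gcongr
  obtain ⟨t, ht, hb, hsep⟩ := exists_separated_finset
    (E := cosSpan (d := d) (⟨0, hdIn⟩ : Fin dIn) N) (2 ^ N ^ d) (by rw [finrank_cosSpan hd])
  let e : Fin (2 ^ N ^ d) ≃ t := (finCongr ht.symm).trans t.equivFin.symm
  refine ⟨fun i => ⟨r • ((e i).1.1 : L2 d dIn), ?_⟩, fun i j hij => ?_⟩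
  · refine mem_sobolevBall_of_mem_cosSpan hs (Submodule.smul_mem _ r (e i).1.2) (le_trans ?_ hW)
    gcongr
    rw [norm_smul, Real.norm_of_nonneg hr0.le]
    exact mul_le_of_le_one_right hr0.le (hb _ (e i).2)
  · have h : 1 / 2 ≤ dist ((e i).1.1 : L2 d dIn) (e j).1.1 :=
      hsep _ (e i).2 _ (e j).2 fun h => hij (e.injective (Subtype.ext h))
    rw [Subtype.dist_eq, dist_smul₀, Real.norm_of_nonneg hr0.le]
    calc C ^ (-s / 2) / 2 * (N : ℝ) ^ (-s) = r * (1 / 2) := by rw [hr]; ring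
      _ ≤ _ := by gcongr

/-! ### Stability of networks under perturbation of the parameters -/

/-- The `L¹` norm of a hidden state, with the `ℓ¹` norm on the channels. Since
`|v̂(k)| ≤ ‖v‖_{L¹}`, it controls the non-local operators. -/
def l1Norm {d n : ℕ} (v : UnitAddTorus (Fin d) → Fin n → ℝ) : ℝ :=
  ∑ j, ∫ x, |v x j| ∂torusMeasure d

/-- All channels of a hidden state are integrable. -/
def IntegrableState {d n : ℕ} (v : UnitAddTorus (Fin d) → Fin n → ℝ) : Prop :=
  ∀ j, Integrable (fun x => v x j) (torusMeasure d)

lemma l1Norm_nonneg {d n : ℕ} (v : UnitAddTorus (Fin d) → Fin n → ℝ) : 0 ≤ l1Norm v :=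
  Finset.sum_nonneg fun _ _ => integral_nonneg fun _ => abs_nonneg _

lemma l1Norm_le_of_forall {d n : ℕ} {v : UnitAddTorus (Fin d) → Fin n → ℝ} {C : ℝ}
    (h : ∀ j, ∫ x, |v x j| ∂torusMeasure d ≤ C) : l1Norm v ≤ n * C :=
  (Finset.sum_le_sum fun j _ => h j).trans_eq (by simp)

lemma IntegrableState.sub {d n : ℕ} {v w : UnitAddTorus (Fin d) → Fin n → ℝ}
    (hv : IntegrableState v) (hw : IntegrableState w) : IntegrableState (v - w) :=
  fun j => (hv j).sub (hw j)

lemma integrable_dotProduct {d n : ℕ} {v : UnitAddTorus (Fin d) → Fin n → ℝ}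
    (hv : IntegrableState v) (a : Fin n → ℝ) :
    Integrable (fun x => a ⬝ᵥ v x) (torusMeasure d) :=
  integrable_finsetSum _ fun j _ => (hv j).const_mul (a j)

lemma integral_abs_dotProduct_le {d n : ℕ} {v : UnitAddTorus (Fin d) → Fin n → ℝ}
    (hv : IntegrableState v) {a : Fin n → ℝ} {M : ℝ} (ha : ∀ j, |a j| ≤ M) :
    ∫ x, |a ⬝ᵥ v x| ∂torusMeasure d ≤ M * l1Norm v := by
  rw [l1Norm, ← integral_finsetSum _ fun j _ => (hv j).abs, ← integral_const_mul]
  refine integral_mono (integrable_dotProduct hv a).abs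
    ((integrable_finsetSum _ fun j _ => (hv j).abs).const_mul M) fun x => ?_
  simp only [dotProduct, Finset.mul_sum]
  refine (Finset.abs_sum_le_sum_abs _ _).trans (Finset.sum_le_sum fun j _ => ?_)
  rw [abs_mul]
  exact mul_le_mul_of_nonneg_right (ha j) (abs_nonneg _)

lemma norm_fcoeff_le {d : ℕ} (f : UnitAddTorus (Fin d) → ℝ) (k : Fin d → ℤ) :
    ‖fcoeff f k‖ ≤ ∫ x, |f x| ∂torusMeasure d := by
  refine (norm_integral_le_integral_norm _).trans_eq (integral_congr_ae ?_)
  refine Eventually.of_forall fun x => ?_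
  simp only [norm_smul, norm_mFourier_apply, one_mul, Complex.norm_real, Real.norm_eq_abs]

lemma fcoeff_sub {d : ℕ} {f g : UnitAddTorus (Fin d) → ℝ} (hf : Integrable f (torusMeasure d))
    (hg : Integrable g (torusMeasure d)) (k : Fin d → ℤ) :
    fcoeff (fun x => f x - g x) k = fcoeff f k - fcoeff g k := by
  refine Eq.trans ?_ (integral_sub (integrable_mFourier_smul_ofReal hf (-k))
    (integrable_mFourier_smul_ofReal hg (-k)))
  refine integral_congr_ae (Eventually.of_forall fun x => ?_)
  simp [mul_sub]

/-- All parameters of the layer are bounded by `M`. -/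
def Layer.ParamsLE {d dc κ : ℕ} (ℓ : Layer d dc κ) (M : ℝ) : Prop :=
  (∀ i j, |ℓ.W i j| ≤ M) ∧
    (∀ k i j, |(ℓ.mult k i j).re| ≤ M ∧ |(ℓ.mult k i j).im| ≤ M) ∧ ∀ i, |ℓ.b i| ≤ M

/-- The difference of two layers, taken parameter by parameter. -/
instance {d dc κ : ℕ} : Sub (Layer d dc κ) :=
  ⟨fun ℓ ℓ' => ⟨ℓ.W - ℓ'.W, ℓ.mult - ℓ'.mult, ℓ.b - ℓ'.b⟩⟩

/-- The linear part `W v + K v` of a hidden layer. -/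
def Layer.lin {d dc κ : ℕ} (ℓ : Layer d dc κ) (v : UnitAddTorus (Fin d) → Fin dc → ℝ)
    (x : UnitAddTorus (Fin d)) (i : Fin dc) : ℝ :=
  (ℓ.W *ᵥ v x) i + ℓ.nonlocal v x i

lemma Layer.continuous_nonlocal {d dc κ : ℕ} (ℓ : Layer d dc κ)
    (v : UnitAddTorus (Fin d) → Fin dc → ℝ) (i : Fin dc) :
    Continuous fun x => ℓ.nonlocal v x i := by
  unfold Layer.nonlocal
  fun_prop

lemma Layer.abs_nonlocal_le {d dc κ : ℕ} {ℓ : Layer d dc κ} {M : ℝ}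
    (hℓ : ∀ k i j, |(ℓ.mult k i j).re| ≤ M ∧ |(ℓ.mult k i j).im| ≤ M)
    (v : UnitAddTorus (Fin d) → Fin dc → ℝ) (x : UnitAddTorus (Fin d)) (i : Fin dc) :
    |ℓ.nonlocal v x i| ≤ (modes d κ).card * (2 * M * l1Norm v) := by
  refine (Complex.abs_re_le_norm _).trans ((norm_sum_le _ _).trans ?_)
  refine (Finset.sum_le_card_nsmul _ _ (2 * M * l1Norm v) fun k _ => ?_).trans_eq (by simp)
  rw [norm_mul, norm_mFourier_apply, mul_one, l1Norm, Finset.mul_sum]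
  refine (norm_sum_le _ _).trans (Finset.sum_le_sum fun j _ => ?_)
  rw [norm_mul]
  refine mul_le_mul ?_ (norm_fcoeff_le _ _) (norm_nonneg _) ?_
  · have := Complex.norm_le_abs_re_add_abs_im (ℓ.mult k i j)
    linarith [(hℓ k i j).1, (hℓ k i j).2]
  · linarith [(abs_nonneg _).trans (hℓ k i j).1]

lemma Layer.integrable_lin {d dc κ : ℕ} (ℓ : Layer d dc κ)
    {v : UnitAddTorus (Fin d) → Fin dc → ℝ} (hv : IntegrableState v) :
    IntegrableState (ℓ.lin v) := fun i =>
  (integrable_dotProduct hv (ℓ.W i)).add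
    ((BoundedContinuousFunction.mkOfCompact ⟨_, ℓ.continuous_nonlocal v i⟩).integrable _)

lemma Layer.integral_abs_lin_le {d dc κ : ℕ} {ℓ : Layer d dc κ} {M : ℝ} (hℓ : ℓ.ParamsLE M)
    {v : UnitAddTorus (Fin d) → Fin dc → ℝ} (hv : IntegrableState v) (i : Fin dc) :
    ∫ x, |ℓ.lin v x i| ∂torusMeasure d ≤ (1 + 2 * (modes d κ).card) * M * l1Norm v := by
  have h1 := integral_abs_dotProduct_le hv (hℓ.1 i)
  have hi := (integrable_dotProduct hv (ℓ.W i)).abs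
  calc ∫ x, |ℓ.lin v x i| ∂torusMeasure d
      ≤ ∫ x, (|ℓ.W i ⬝ᵥ v x| + (modes d κ).card * (2 * M * l1Norm v)) ∂torusMeasure d := by
        refine integral_mono (ℓ.integrable_lin hv i).abs (hi.add (integrable_const _)) fun x => ?_
        exact (abs_add_le _ _).trans
          (add_le_add le_rfl (Layer.abs_nonlocal_le hℓ.2.1 v x i))
    _ = ∫ x, |ℓ.W i ⬝ᵥ v x| ∂torusMeasure d + (modes d κ).card * (2 * M * l1Norm v) := by
        rw [integral_add hi (integrable_const _)]
        simp
    _ ≤ _ := by linarith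

/-- The linear part is bilinear in the parameters and the state. -/
lemma Layer.lin_sub_lin {d dc κ : ℕ} (ℓ ℓ' : Layer d dc κ)
    {v v' : UnitAddTorus (Fin d) → Fin dc → ℝ} (hv : IntegrableState v)
    (hv' : IntegrableState v') (x : UnitAddTorus (Fin d)) (i : Fin dc) :
    ℓ.lin v x i - ℓ'.lin v' x i = ℓ.lin (v - v') x i + (ℓ - ℓ').lin v' x i := by
  have hW : (ℓ - ℓ').W = ℓ.W - ℓ'.W := rfl
  have hm : (ℓ - ℓ').mult = ℓ.mult - ℓ'.mult := rfl
  have h1 : (ℓ.W *ᵥ v x) i - (ℓ'.W *ᵥ v' x) i =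
      (ℓ.W *ᵥ (v - v') x) i + ((ℓ - ℓ').W *ᵥ v' x) i := by
    rw [hW, Pi.sub_apply, Matrix.mulVec_sub, Matrix.sub_mulVec, Pi.sub_apply, Pi.sub_apply]
    ring
  have h2 : ℓ.nonlocal v x i - ℓ'.nonlocal v' x i =
      ℓ.nonlocal (v - v') x i + (ℓ - ℓ').nonlocal v' x i := by
    simp only [Layer.nonlocal, ← Complex.sub_re, ← Complex.add_re, hm, Pi.sub_apply,
      Matrix.sub_apply, ← Finset.sum_sub_distrib, ← Finset.sum_add_distrib]
    congr 1
    refine Finset.sum_congr rfl fun k _ => ?_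
    rw [← sub_mul, ← add_mul, ← Finset.sum_sub_distrib, ← Finset.sum_add_distrib]
    congr 1
    refine Finset.sum_congr rfl fun j _ => ?_
    rw [fcoeff_sub (hv j) (hv' j)]
    ring
  unfold Layer.lin
  linarith

section Lipschitz

variable {d dc κ : ℕ} {σ : ℝ → ℝ} {c : ℝ≥0}

lemma abs_le_of_lipschitz (hσ : LipschitzWith c σ) (t : ℝ) : |σ t| ≤ |σ 0| + c * |t| := by
  have h := hσ.dist_le_mul t 0
  rw [Real.dist_eq, Real.dist_eq, sub_zero] at h
  linarith [abs_sub_abs_le_abs_sub (σ t) (σ 0)]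

lemma Layer.integrable_apply (hσ : LipschitzWith c σ) (ℓ : Layer d dc κ)
    {v : UnitAddTorus (Fin d) → Fin dc → ℝ} (hv : IntegrableState v) :
    IntegrableState (ℓ.apply σ v) := fun i => by
  have h : Integrable (fun x => ℓ.lin v x i + ℓ.b i) (torusMeasure d) :=
    (ℓ.integrable_lin hv i).add (integrable_const _)
  refine Integrable.mono' ((integrable_const |σ 0|).add (h.abs.const_mul (c : ℝ)))
    (hσ.continuous.comp_aestronglyMeasurable h.aestronglyMeasurable)
    (Eventually.of_forall fun x => abs_le_of_lipschitz hσ _)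

/-- The factor by which one hidden layer, with parameters bounded by `R`, can enlarge both the
state and the perturbation of the state. -/
def growth (d dc κ : ℕ) (σ : ℝ → ℝ) (c : ℝ≥0) (R : ℝ) : ℝ :=
  2 * (1 + dc * (|σ 0| + c * ((1 + 2 * (modes d κ).card) * R)))

lemma Layer.l1Norm_apply_le (hσ : LipschitzWith c σ) {ℓ : Layer d dc κ} {R A : ℝ}
    (hℓ : ℓ.ParamsLE R) (hR : 0 ≤ R) {v : UnitAddTorus (Fin d) → Fin dc → ℝ}
    (hv : IntegrableState v) (hA : l1Norm v + 1 ≤ A) :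
    l1Norm (ℓ.apply σ v) + 1 ≤ growth d dc κ σ c R * A := by
  set m : ℝ := ((modes d κ).card : ℝ)
  have hm : 0 ≤ m := Nat.cast_nonneg _
  have h1 : ∀ i, ∫ x, |ℓ.apply σ v x i| ∂torusMeasure d ≤
      |σ 0| + c * ((1 + 2 * m) * R * l1Norm v + R) := fun i => by
    have hL := (ℓ.integrable_lin hv i).abs
    have hLR : Integrable (fun x => |ℓ.lin v x i| + R) (torusMeasure d) :=
      hL.add (integrable_const _)
    calc ∫ x, |ℓ.apply σ v x i| ∂torusMeasure d
        ≤ ∫ x, (|σ 0| + c * (|ℓ.lin v x i| + R)) ∂torusMeasure d := by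
          refine integral_mono (ℓ.integrable_apply hσ hv i).abs
            ((integrable_const _).add (hLR.const_mul _)) fun x => ?_
          refine (abs_le_of_lipschitz hσ _).trans ?_
          gcongr
          exact (abs_add_le _ _).trans (add_le_add le_rfl (hℓ.2.2 i))
      _ = |σ 0| + c * (∫ x, |ℓ.lin v x i| ∂torusMeasure d + R) := by
          rw [integral_add (integrable_const _) (hLR.const_mul _),
            integral_const_mul, integral_add hL (integrable_const _)]
          simp
      _ ≤ _ := by
          gcongr
          exact Layer.integral_abs_lin_le hℓ hv i
  have h2 := l1Norm_le_of_forall h1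
  have hN := l1Norm_nonneg v
  have h3 : (dc : ℝ) * (|σ 0| + c * ((1 + 2 * m) * R * l1Norm v + R)) + 1 ≤
      (1 + dc * (|σ 0| + c * ((1 + 2 * m) * R))) * (l1Norm v + 1) := by
    have e : (1 + dc * (|σ 0| + c * ((1 + 2 * m) * R))) * (l1Norm v + 1) -
      ((dc : ℝ) * (|σ 0| + c * ((1 + 2 * m) * R * l1Norm v + R)) + 1) =
      l1Norm v + dc * |σ 0| * l1Norm v + dc * (c * (2 * m * R)) := by ring
    have : 0 ≤ l1Norm v + dc * |σ 0| * l1Norm v + dc * (c * (2 * m * R)) := by positivity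
    linarith
  have h4 : (1 + dc * (|σ 0| + c * ((1 + 2 * m) * R))) * (l1Norm v + 1) ≤
      (1 + dc * (|σ 0| + c * ((1 + 2 * m) * R))) * A := by gcongr
  have h5 : 0 ≤ (1 + dc * (|σ 0| + c * ((1 + 2 * m) * R))) * A := by
    have : 0 ≤ A := by linarith
    positivity
  calc l1Norm (ℓ.apply σ v) + 1 ≤ 2 * ((1 + dc * (|σ 0| + c * ((1 + 2 * m) * R))) * A) := by
        linarith
    _ = _ := by simp only [growth, m]; ring

lemma Layer.l1Norm_apply_sub_le (hσ : LipschitzWith c σ) {ℓ ℓ' : Layer d dc κ} {R δ A : ℝ}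
    (hℓ : ℓ.ParamsLE R) (hR : 1 ≤ R) (hδ : 0 ≤ δ) (hℓ' : (ℓ - ℓ').ParamsLE δ)
    {v v' : UnitAddTorus (Fin d) → Fin dc → ℝ} (hv : IntegrableState v)
    (hv' : IntegrableState v') (hA : l1Norm v' + 1 ≤ A) (hvv' : l1Norm (v - v') ≤ δ * A) :
    l1Norm (ℓ.apply σ v - ℓ'.apply σ v') ≤ δ * (growth d dc κ σ c R * A) := by
  set m : ℝ := ((modes d κ).card : ℝ)
  have hm : 0 ≤ m := Nat.cast_nonneg _
  have h1 : ∀ i, ∫ x, |(ℓ.apply σ v - ℓ'.apply σ v') x i| ∂torusMeasure d ≤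
      c * ((1 + 2 * m) * R * l1Norm (v - v') + (1 + 2 * m) * δ * l1Norm v' + δ) := fun i => by
    have hL := (ℓ.integrable_lin (hv.sub hv') i).abs
    have hL' := ((ℓ - ℓ').integrable_lin hv' i).abs
    have hLL : Integrable (fun x => |ℓ.lin (v - v') x i| + |(ℓ - ℓ').lin v' x i|)
      (torusMeasure d) := hL.add hL'
    calc ∫ x, |(ℓ.apply σ v - ℓ'.apply σ v') x i| ∂torusMeasure d
        ≤ ∫ x, c * (|ℓ.lin (v - v') x i| + |(ℓ - ℓ').lin v' x i| + δ) ∂torusMeasure d := by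
          refine integral_mono
            ((ℓ.integrable_apply hσ hv).sub (ℓ'.integrable_apply hσ hv') i).abs
            ((hLL.add (integrable_const _)).const_mul _) fun x => ?_
          refine (hσ.dist_le_mul _ _).trans ?_
          gcongr
          have h := Layer.lin_sub_lin ℓ ℓ' hv hv' x i
          unfold Layer.lin at h ⊢
          rw [Real.dist_eq]
          calc _ = |(((ℓ.W *ᵥ (v - v') x) i + ℓ.nonlocal (v - v') x i) +
                (((ℓ - ℓ').W *ᵥ v' x) i + (ℓ - ℓ').nonlocal v' x i)) + (ℓ - ℓ').b i| := by
                rw [← h]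
                congr 1
                change _ = _ + (ℓ.b i - ℓ'.b i)
                ring
            _ ≤ _ := (abs_add_le _ _).trans (add_le_add (abs_add_le _ _) (hℓ'.2.2 i))
      _ = c * (∫ x, |ℓ.lin (v - v') x i| ∂torusMeasure d +
            ∫ x, |(ℓ - ℓ').lin v' x i| ∂torusMeasure d + δ) := by
          rw [integral_const_mul, integral_add hLL (integrable_const _),
            integral_add hL hL']
          simp
      _ ≤ _ := by
          gcongr
          · exact Layer.integral_abs_lin_le hℓ (hv.sub hv') i
          · exact Layer.integral_abs_lin_le hℓ' hv' i
  have hN := l1Norm_nonneg v'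
  have hA0 : 0 ≤ A := by linarith
  calc l1Norm (ℓ.apply σ v - ℓ'.apply σ v')
      ≤ dc * (c * ((1 + 2 * m) * R * l1Norm (v - v') + (1 + 2 * m) * δ * l1Norm v' + δ)) :=
        l1Norm_le_of_forall h1
    _ ≤ dc * (c * ((1 + 2 * m) * R * (δ * A) + (1 + 2 * m) * R * δ * A)) := by
        have e : (1 + 2 * m) * δ * l1Norm v' + δ ≤ (1 + 2 * m) * R * δ * A := by
          calc (1 + 2 * m) * δ * l1Norm v' + δ ≤ (1 + 2 * m) * δ * (l1Norm v' + 1) := by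
                nlinarith [mul_nonneg hm hδ]
            _ ≤ (1 + 2 * m) * δ * A := by gcongr
            _ ≤ (1 + 2 * m) * δ * A * R := le_mul_of_one_le_right (by positivity) hR
            _ = (1 + 2 * m) * R * δ * A := by ring
        rw [add_assoc]
        gcongr
    _ = δ * (2 * (dc * (c * ((1 + 2 * m) * R))) * A) := by ring
    _ ≤ _ := by
        unfold growth
        gcongr
        have : 0 ≤ (dc : ℝ) * |σ 0| := by positivity
        linarith

/-- Propagation of a perturbation through the hidden layers: the invariant is that a state of size
at most `A` carries a perturbation of size at most `δ A`. -/
lemma l1Norm_foldl_sub_le (hσ : LipschitzWith c σ) {R δ : ℝ} (hR : 1 ≤ R) (hδ : 0 ≤ δ)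
    {l l' : List (Layer d dc κ)} (hl : ∀ ℓ ∈ l, ℓ.ParamsLE R) (hl' : ∀ ℓ ∈ l', ℓ.ParamsLE R)
    (h : List.Forall₂ (fun ℓ ℓ' => (ℓ - ℓ').ParamsLE δ) l l') {A : ℝ}
    {v v' : UnitAddTorus (Fin d) → Fin dc → ℝ} (hv : IntegrableState v)
    (hv' : IntegrableState v') (hA : l1Norm v' + 1 ≤ A) (hvv' : l1Norm (v - v') ≤ δ * A) :
    IntegrableState (l.foldl (fun v ℓ => ℓ.apply σ v) v) ∧
    IntegrableState (l'.foldl (fun v ℓ => ℓ.apply σ v) v') ∧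
    l1Norm (l'.foldl (fun v ℓ => ℓ.apply σ v) v') + 1 ≤ growth d dc κ σ c R ^ l.length * A ∧
    l1Norm (l.foldl (fun v ℓ => ℓ.apply σ v) v - l'.foldl (fun v ℓ => ℓ.apply σ v) v') ≤
      δ * (growth d dc κ σ c R ^ l.length * A) := by
  induction h generalizing v v' A with
  | nil => simpa using ⟨hv, hv', hA, hvv'⟩
  | @cons ℓ ℓ' l l' hℓ _ ih =>
    have h := ih (fun k hk => hl k (List.mem_cons_of_mem _ hk))
      (fun k hk => hl' k (List.mem_cons_of_mem _ hk))
      (ℓ.integrable_apply hσ hv) (ℓ'.integrable_apply hσ hv')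
      (Layer.l1Norm_apply_le hσ (hl' ℓ' List.mem_cons_self) (by linarith) hv' hA)
      (Layer.l1Norm_apply_sub_le hσ (hl ℓ List.mem_cons_self) hR hδ hℓ hv hv' hA hvv')
    simpa only [List.foldl_cons, List.length_cons, pow_succ, mul_assoc] using h

/-- Networks of the same architecture depend on their parameters in a Lipschitz way, uniformly on
the unit ball of `L²`. -/
lemma abs_eval_sub_eval_le {dIn : ℕ} (hσ : LipschitzWith c σ) {R δ : ℝ} (hR : 1 ≤ R) (hδ : 0 ≤ δ)
    {P P' : Matrix (Fin dc) (Fin dIn) ℝ} {l l' : List (Layer d dc κ)} {Q Q' : Fin dc → ℝ}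
    (hΦ : (⟨dc, κ, P, l, Q⟩ : Network d dIn).ParamsLE R)
    (hΦ' : (⟨dc, κ, P', l', Q'⟩ : Network d dIn).ParamsLE R)
    (hP : ∀ i j, |P i j - P' i j| ≤ δ)
    (hl : List.Forall₂ (fun ℓ ℓ' => (ℓ - ℓ').ParamsLE δ) l l') (hQ : ∀ i, |Q i - Q' i| ≤ δ)
    {u : L2 d dIn} (hu : ‖u‖ ≤ 1) :
    |(⟨dc, κ, P, l, Q⟩ : Network d dIn).eval σ u - (⟨dc, κ, P', l', Q'⟩ : Network d dIn).eval σ u|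
      ≤ δ * (2 * R * (growth d dc κ σ c R ^ l.length * (dc * (R * dIn) + 1))) := by
  have hui : IntegrableState (fun x j => u x j) := integrable_component u
  have hu1 : l1Norm (fun x j => u x j) ≤ dIn :=
    (l1Norm_le_of_forall (integral_abs_component_le_one hu)).trans_eq (mul_one _)
  have hM : ∀ (S : Matrix (Fin dc) (Fin dIn) ℝ) (M : ℝ), 0 ≤ M → (∀ i j, |S i j| ≤ M) →
      l1Norm (fun x => S *ᵥ fun j => u x j) ≤ dc * (M * dIn) := fun S M hM0 hM => by
    refine l1Norm_le_of_forall fun i => (integral_abs_dotProduct_le hui (hM i)).trans ?_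
    gcongr
  obtain ⟨h1, h2, h3, h4⟩ := l1Norm_foldl_sub_le hσ hR hδ hΦ.2.1 hΦ'.2.1 hl
    (A := dc * (R * dIn) + 1) (v := fun x => P *ᵥ fun j => u x j)
    (v' := fun x => P' *ᵥ fun j => u x j)
    (fun i => integrable_dotProduct hui (P i)) (fun i => integrable_dotProduct hui (P' i))
    (by linarith [hM P' R (by linarith) hΦ'.1]) (by
      have e : (fun x => P *ᵥ fun j => u x j) - (fun x => P' *ᵥ fun j => u x j) =
          fun x => (P - P') *ᵥ fun j => u x j := by
        funext x
        rw [Pi.sub_apply, Matrix.sub_mulVec]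
      rw [e]
      refine (hM (P - P') δ hδ hP).trans ?_
      have : (0 : ℝ) ≤ δ * (dc * dIn) := by positivity
      nlinarith)
  set h := l.foldl (fun v ℓ => ℓ.apply σ v) (fun x => P *ᵥ fun j => u x j)
  set h' := l'.foldl (fun v ℓ => ℓ.apply σ v) (fun x => P' *ᵥ fun j => u x j)
  set A := growth d dc κ σ c R ^ l.length * (dc * (R * dIn) + 1)
  have e : (⟨dc, κ, P, l, Q⟩ : Network d dIn).eval σ u -
      (⟨dc, κ, P', l', Q'⟩ : Network d dIn).eval σ u =
      ∫ x, Q ⬝ᵥ (h - h') x ∂torusMeasure d + ∫ x, (Q - Q') ⬝ᵥ h' x ∂torusMeasure d := by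
    rw [← integral_add (integrable_dotProduct (h1.sub h2) Q) (integrable_dotProduct h2 _)]
    refine (integral_sub (integrable_dotProduct h1 Q) (integrable_dotProduct h2 Q')).symm.trans ?_
    refine integral_congr_ae (Eventually.of_forall fun x => ?_)
    simp only [Pi.sub_apply, dotProduct_sub, sub_dotProduct]
    ring
  rw [e]
  have hA := l1Norm_nonneg h'
  calc _ ≤ ∫ x, |Q ⬝ᵥ (h - h') x| ∂torusMeasure d + ∫ x, |(Q - Q') ⬝ᵥ h' x| ∂torusMeasure d :=
        (abs_add_le _ _).trans (add_le_add (abs_integral_le_integral_abs)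
          (abs_integral_le_integral_abs))
    _ ≤ R * l1Norm (h - h') + δ * l1Norm h' :=
        add_le_add (integral_abs_dotProduct_le (h1.sub h2) hΦ.2.2)
          (integral_abs_dotProduct_le h2 hQ)
    _ ≤ R * (δ * A) + δ * A := by gcongr; linarith
    _ ≤ δ * (2 * R * A) := by
        have : 0 ≤ δ * A := mul_nonneg hδ (by linarith)
        nlinarith

end Lipschitz

/-! ### Counting networks up to small errors -/

/-- The pigeonhole principle for vectors in a box, with respect to a grid of mesh `δ`. -/
lemma exists_ne_forall_abs_sub_le {T ι : Type*} [Fintype T] [Fintype ι] {p : T → ι → ℝ} {R δ : ℝ}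
    (hδ : 0 < δ) (hp : ∀ t i, |p t i| ≤ R) {K : ℕ} (hK : R / δ ≤ K)
    (hcard : (2 * K + 1) ^ Fintype.card ι < Fintype.card T) :
    ∃ t t', t ≠ t' ∧ ∀ i, |p t i - p t' i| ≤ δ := by
  classical
  have hmem : ∀ t i, ⌊p t i / δ⌋ ∈ Finset.Icc (-(K : ℤ)) K := fun t i => by
    have h : |p t i / δ| ≤ K := by
      rw [abs_div, abs_of_pos hδ]
      exact (div_le_div_of_nonneg_right (hp t i) hδ.le).trans hK
    rw [Finset.mem_Icc, Int.le_floor]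
    refine ⟨by push_cast; exact (abs_le.1 h).1, ?_⟩
    exact_mod_cast (Int.floor_le _).trans (abs_le.1 h).2
  obtain ⟨t, t', hne, h⟩ := Fintype.exists_ne_map_eq_of_card_lt
    (fun t i => (⟨_, hmem t i⟩ : Finset.Icc (-(K : ℤ)) K)) (by
      rw [Fintype.card_fun, Fintype.card_coe, Int.card_Icc]
      convert hcard using 2
      omega)
  refine ⟨t, t', hne, fun i => ?_⟩
  have hi := Int.abs_sub_lt_one_of_floor_eq_floor (Subtype.ext_iff.1 (congrFun h i))
  rw [← sub_div, abs_div, abs_of_pos hδ, div_lt_one hδ] at hi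
  exact hi.le

/-- The index set of the real parameters of a network with input dimension `dIn`, width `dc`,
cut-off `κ` and depth `L`. -/
abbrev ParamIndex (d dIn dc κ L : ℕ) : Type :=
  (Fin dc × Fin dIn) ⊕ (Fin L × ((Fin dc × Fin dc) ⊕
    ((modes d κ × Fin dc × Fin dc) ⊕ (modes d κ × Fin dc × Fin dc)) ⊕ Fin dc)) ⊕ Fin dc

/-- The vector of the real parameters of a network. -/
def paramVec {d dIn dc κ L : ℕ} (P : Matrix (Fin dc) (Fin dIn) ℝ) (f : Fin L → Layer d dc κ)
    (Q : Fin dc → ℝ) : ParamIndex d dIn dc κ L → ℝ :=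
  Sum.elim (fun i => P i.1 i.2) <| Sum.elim
    (fun i => Sum.elim (fun a : Fin dc × Fin dc => (f i.1).W a.1 a.2) (Sum.elim (Sum.elim
      (fun a => ((f i.1).mult a.1 a.2.1 a.2.2).re) (fun a => ((f i.1).mult a.1 a.2.1 a.2.2).im))
      (f i.1).b) i.2) Q

lemma card_paramIndex_le {d dIn dc κ L : ℕ} (P : Matrix (Fin dc) (Fin dIn) ℝ)
    (f : Fin L → Layer d dc κ) (Q : Fin dc → ℝ) :
    Fintype.card (ParamIndex d dIn dc κ L) ≤
      2 * (⟨dc, κ, P, List.ofFn f, Q⟩ : Network d dIn).numParams := by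
  simp only [Network.numParams, Fintype.card_sum, Fintype.card_prod, Fintype.card_fin,
    Fintype.card_coe, List.length_ofFn]
  have : L * (dc * dc + ((modes d κ).card * (dc * dc) + (modes d κ).card * (dc * dc) + dc)) ≤
      2 * (L * (dc ^ 2 + (modes d κ).card * dc ^ 2 + dc)) := by
    rw [mul_left_comm 2 L]
    gcongr
    nlinarith
  omega

lemma abs_paramVec_le {d dIn dc κ L : ℕ} {P : Matrix (Fin dc) (Fin dIn) ℝ}
    {f : Fin L → Layer d dc κ} {Q : Fin dc → ℝ} {R : ℝ}
    (h : (⟨dc, κ, P, List.ofFn f, Q⟩ : Network d dIn).ParamsLE R) (i) :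
    |paramVec P f Q i| ≤ R := by
  obtain ⟨hP, hl, hQ⟩ := h
  have hf : ∀ i, (f i).ParamsLE R := fun i => hl _ (List.mem_ofFn.2 ⟨i, rfl⟩)
  rcases i with i | ⟨i, a | (a | a) | a⟩ | i
  · exact hP _ _
  · exact (hf i).1 _ _
  · exact ((hf i).2.1 _ _ _).1
  · exact ((hf i).2.1 _ _ _).2
  · exact (hf i).2.2 _
  · exact hQ _

lemma forall₂_ofFn_paramsLE {d dIn dc κ L : ℕ} {P P' : Matrix (Fin dc) (Fin dIn) ℝ}
    {f f' : Fin L → Layer d dc κ} {Q Q' : Fin dc → ℝ} {δ : ℝ}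
    (h : ∀ i, |paramVec P f Q i - paramVec P' f' Q' i| ≤ δ) :
    List.Forall₂ (fun ℓ ℓ' => (ℓ - ℓ').ParamsLE δ) (List.ofFn f) (List.ofFn f') := by
  rw [List.forall₂_iff_get]
  refine ⟨by simp, fun i hi hi' => ?_⟩
  simp only [List.get_eq_getElem, List.getElem_ofFn]
  have hi : i < L := by simpa using hi
  exact ⟨fun a b => h (.inr (.inl (⟨i, hi⟩, .inl (a, b)))),
    fun k a b => ⟨h (.inr (.inl (⟨i, hi⟩, .inr (.inl (.inl (k, a, b)))))),
      h (.inr (.inl (⟨i, hi⟩, .inr (.inl (.inr (k, a, b))))))⟩,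
    fun a => h (.inr (.inl (⟨i, hi⟩, .inr (.inr a))))⟩

lemma growth_mono {d dc κ q : ℕ} {σ : ℝ → ℝ} {c : ℝ≥0} {R : ℝ} (hR : 0 ≤ R) (hdc : dc ≤ q)
    (hκ : (modes d κ).card ≤ q) :
    growth d dc κ σ c R ≤ 2 * (1 + q * (|σ 0| + c * ((1 + 2 * q) * R))) := by
  unfold growth
  gcongr

lemma one_le_growth {d dc κ : ℕ} {σ : ℝ → ℝ} {c : ℝ≥0} {R : ℝ} (hR : 0 ≤ R) :
    1 ≤ growth d dc κ σ c R := by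
  unfold growth
  have : 0 ≤ dc * (|σ 0| + c * ((1 + 2 * ((modes d κ).card : ℝ)) * R)) := by positivity
  linarith

/-- Among sufficiently many networks of one architecture, two have nearly the same output. -/
lemma exists_ne_abs_eval_sub_le_of_arch {d dIn : ℕ} {σ : ℝ → ℝ} {c : ℝ≥0} (hσ : LipschitzWith c σ)
    {T : Type*} [Fintype T] {Φ : T → Network d dIn} {R δ : ℝ} (hR : 1 ≤ R) (hδ : 0 < δ)
    {K q dc κ L : ℕ} (hK : R / δ ≤ K) (hcard : (2 * K + 1) ^ (2 * q) < Fintype.card T)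
    (hdc : ∀ t, (Φ t).dc = dc) (hκ : ∀ t, (Φ t).κ = κ) (hL : ∀ t, (Φ t).layers.length = L)
    (hnum : ∀ t, (Φ t).numParams ≤ q) (hΦ : ∀ t, (Φ t).ParamsLE R)
    (hdcq : dc ≤ q) (hm : (modes d κ).card ≤ q) (hLq : L ≤ q) :
    ∃ t t', t ≠ t' ∧ ∀ u : L2 d dIn, ‖u‖ ≤ 1 → |(Φ t).eval σ u - (Φ t').eval σ u| ≤
      δ * (2 * R * ((2 * (1 + q * (|σ 0| + c * ((1 + 2 * q) * R)))) ^ q *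
        (q * (R * dIn) + 1))) := by
  have hR0 : 0 ≤ R := by linarith
  have hrep : ∀ t, ∃ (P : Matrix (Fin dc) (Fin dIn) ℝ) (f : Fin L → Layer d dc κ)
      (Q : Fin dc → ℝ), Φ t = ⟨dc, κ, P, List.ofFn f, Q⟩ := fun t => by
    have h1 := hdc t
    have h2 := hκ t
    have h3 := hL t
    generalize Φ t = Ψ at h1 h2 h3 ⊢
    rcases Ψ with ⟨dc', κ', P, l, Q⟩
    subst h1 h2 h3
    exact ⟨P, l.get, Q, by rw [List.ofFn_get]⟩
  choose P f Q hrep using hrep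
  simp only [hrep] at hnum hΦ ⊢
  obtain ⟨t₀⟩ : Nonempty T := Fintype.card_pos_iff.1 (by omega)
  obtain ⟨t, t', hne, h⟩ := exists_ne_forall_abs_sub_le (p := fun t => paramVec (P t) (f t) (Q t))
    hδ (fun t => abs_paramVec_le (hΦ t)) hK
    ((Nat.pow_le_pow_right (by omega) ((card_paramIndex_le (P t₀) (f t₀) (Q t₀)).trans
      (Nat.mul_le_mul_left 2 (hnum t₀)))).trans_lt hcard)
  refine ⟨t, t', hne, fun u hu => (abs_eval_sub_eval_le hσ hR hδ.le (hΦ t) (hΦ t')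
    (fun i j => h (.inl (i, j))) (forall₂_ofFn_paramsLE h) (fun i => h (.inr (.inr i)))
    hu).trans ?_⟩
  have hG := growth_mono (d := d) (σ := σ) (c := c) hR0 hdcq hm
  have hG1 := one_le_growth (d := d) (dc := dc) (κ := κ) (σ := σ) (c := c) hR0
  rw [List.length_ofFn]
  gcongr
  exact (pow_le_pow_left₀ (by linarith) hG L).trans (pow_le_pow_right₀ (hG1.trans hG) hLq)

/-- The cut-off is not controlled by the number of parameters when the width or the depth is `0`,
but then it does not matter either, and may be taken to be `0`. -/
lemma exists_network_eval_eq {d dIn : ℕ} (hd : 1 ≤ d) (σ : ℝ → ℝ) (Φ : Network d dIn) {q : ℕ}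
    {R : ℝ} (hnum : Φ.numParams ≤ q) (hΦ : Φ.ParamsLE R) :
    ∃ Φ' : Network d dIn, Φ'.eval σ = Φ.eval σ ∧ Φ'.numParams ≤ q ∧ Φ'.ParamsLE R ∧
      Φ'.dc ≤ q ∧ Φ'.κ ≤ q ∧ Φ'.layers.length ≤ q ∧ (modes d Φ'.κ).card ≤ q := by
  have hm0 : (modes d 0).card = 0 := by
    rw [card_modes]
    exact zero_pow (by omega)
  rcases Φ with ⟨dc, κ, P, l, Q⟩
  have hdc : dc ≤ q := le_trans (Nat.le_add_left _ _) hnum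
  rcases Nat.eq_zero_or_pos dc with rfl | hdc0
  · refine ⟨⟨0, 0, P, [], Q⟩, ?_, by simp [Network.numParams], ⟨hΦ.1, by simp, hΦ.2.2⟩, hdc,
      by simp, by simp, by simp [hm0]⟩
    funext u
    simp [Network.eval, dotProduct]
  rcases l with _ | ⟨ℓ, l⟩
  · exact ⟨⟨dc, 0, P, [], Q⟩, rfl, by simpa [Network.numParams] using hnum,
      ⟨hΦ.1, by simp, hΦ.2.2⟩, hdc, by simp, by simp, by simp [hm0]⟩
  have hnum' := hnum
  unfold Network.numParams at hnum'
  simp only at hnum'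
  set L := (ℓ :: l).length
  have hL : 1 ≤ L := by simp [L]
  have hdc2 : 1 ≤ dc ^ 2 := Nat.one_le_pow _ _ hdc0
  have hm : (modes d κ).card ≤ q := by
    calc (modes d κ).card ≤ (modes d κ).card * dc ^ 2 := Nat.le_mul_of_pos_right _ hdc2
      _ ≤ dc ^ 2 + (modes d κ).card * dc ^ 2 + dc := by omega
      _ ≤ L * (dc ^ 2 + (modes d κ).card * dc ^ 2 + dc) := Nat.le_mul_of_pos_left _ hL
      _ ≤ q := by omega
  have hLq : L ≤ q := by
    calc L ≤ L * (dc ^ 2 + (modes d κ).card * dc ^ 2 + dc) :=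
          Nat.le_mul_of_pos_right _ (by omega)
      _ ≤ q := by omega
  refine ⟨⟨dc, κ, P, ℓ :: l, Q⟩, rfl, hnum, hΦ, hdc, ?_, hLq, hm⟩
  rw [card_modes] at hm
  calc κ ≤ 2 * κ - 1 := by omega
    _ ≤ (2 * κ - 1) ^ d := Nat.le_self_pow (by omega) _
    _ ≤ q := hm

lemma exists_ne_abs_eval_sub_le {d dIn : ℕ} (hd : 1 ≤ d) {σ : ℝ → ℝ} {c : ℝ≥0}
    (hσ : LipschitzWith c σ) {T : Type*} [Fintype T] {Φ : T → Network d dIn} {R δ : ℝ}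
    (hR : 1 ≤ R) (hδ : 0 < δ) {K q : ℕ} (hK : R / δ ≤ K)
    (hcard : (q + 1) ^ 3 * (2 * K + 1) ^ (2 * q) < Fintype.card T)
    (hnum : ∀ t, (Φ t).numParams ≤ q) (hΦ : ∀ t, (Φ t).ParamsLE R) :
    ∃ t t', t ≠ t' ∧ ∀ u : L2 d dIn, ‖u‖ ≤ 1 → |(Φ t).eval σ u - (Φ t').eval σ u| ≤
      δ * (2 * R * ((2 * (1 + q * (|σ 0| + c * ((1 + 2 * q) * R)))) ^ q *
        (q * (R * dIn) + 1))) := by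
  classical
  choose Φ' heval hnum' hΦ' hdc hκ hL hm using
    fun t => exists_network_eval_eq hd σ (Φ t) (hnum t) (hΦ t)
  let arch : T → Fin (q + 1) × Fin (q + 1) × Fin (q + 1) := fun t =>
    (⟨(Φ' t).dc, Nat.lt_succ_of_le (hdc t)⟩, ⟨(Φ' t).κ, Nat.lt_succ_of_le (hκ t)⟩,
      ⟨(Φ' t).layers.length, Nat.lt_succ_of_le (hL t)⟩)
  obtain ⟨⟨dc, κ, L⟩, ha⟩ := Fintype.exists_lt_card_fiber_of_mul_lt_card arch
    (n := (2 * K + 1) ^ (2 * q)) (by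
      simp only [Fintype.card_prod, Fintype.card_fin]
      convert hcard using 2
      ring)
  rw [← Fintype.card_subtype] at ha
  have harch : ∀ t : {t // arch t = (dc, κ, L)}, (Φ' t).dc = dc ∧ (Φ' t).κ = κ ∧
      (Φ' t).layers.length = L := fun t => by
    have := t.2
    simp only [arch, Prod.mk.injEq, Fin.ext_iff] at this
    exact this
  obtain ⟨t₀⟩ : Nonempty {t // arch t = (dc, κ, L)} := Fintype.card_pos_iff.1 (by omega)
  obtain ⟨t, t', hne, h⟩ := exists_ne_abs_eval_sub_le_of_arch hσ
    (Φ := fun t : {t // arch t = (dc, κ, L)} => Φ' t) hR hδ hK ha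
    (fun t => (harch t).1) (fun t => (harch t).2.1) (fun t => (harch t).2.2)
    (fun t => hnum' t) (fun t => hΦ' t) (by omega) ((harch t₀).2.1 ▸ hm t₀) (by omega)
  refine ⟨t, t', fun h => hne (Subtype.ext h), fun u hu => ?_⟩
  rw [← heval, ← heval]
  exact h u hu

lemma eventually_const_le_exp (C : ℝ) : ∀ᶠ q : ℕ in atTop, C ≤ Real.exp q :=
  (Real.tendsto_exp_atTop.comp tendsto_natCast_atTop_atTop).eventually_ge_atTop C

/-- With parameters bounded by `exp q` and quantised to a grid of mesh `exp (-q ^ 4)`, the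
perturbation of the output is at most `exp (-q)`. -/
lemma eventually_perturbation_le (dIn : ℕ) (a c : ℝ) (ha : 0 ≤ a) (hc : 0 ≤ c) :
    ∀ᶠ q : ℕ in atTop, Real.exp (-(q : ℝ) ^ 4) * (2 * Real.exp q *
      ((2 * (1 + q * (a + c * ((1 + 2 * q) * Real.exp q)))) ^ q *
        (q * (Real.exp q * dIn) + 1))) ≤ Real.exp (-q) := by
  filter_upwards [eventually_const_le_exp (2 * (1 + a + 3 * c)), eventually_const_le_exp (dIn + 1),
    eventually_ge_atTop 4] with q h1 h2 hq4
  have hq : (4 : ℝ) ≤ q := by exact_mod_cast hq4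
  set E := Real.exp q with hE
  have hqE : (q : ℝ) ≤ E := by linarith [Real.add_one_le_exp (q : ℝ)]
  have hE1 : 1 ≤ E := by linarith
  have hpow : ∀ n : ℕ, E ^ n = Real.exp (n * q) := fun n => by rw [hE, ← Real.exp_nat_mul]
  have hG : 2 * (1 + q * (a + c * ((1 + 2 * q) * E))) ≤ E ^ 4 := by
    have e1 : (1 : ℝ) ≤ E ^ 3 := one_le_pow₀ hE1
    have e2 : (q : ℝ) ≤ E ^ 3 := hqE.trans (le_self_pow₀ hE1 (by norm_num))
    have e3 : (q : ℝ) * ((1 + 2 * q) * E) ≤ 3 * E ^ 3 := by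
      calc (q : ℝ) * ((1 + 2 * q) * E) ≤ E * ((E + 2 * E) * E) := by gcongr
        _ = 3 * E ^ 3 := by ring
    calc 2 * (1 + q * (a + c * ((1 + 2 * q) * E)))
        = 2 * (1 + a * q + c * (q * ((1 + 2 * q) * E))) := by ring
      _ ≤ 2 * (E ^ 3 + a * E ^ 3 + c * (3 * E ^ 3)) := by gcongr
      _ = 2 * (1 + a + 3 * c) * E ^ 3 := by ring
      _ ≤ E * E ^ 3 := by gcongr
      _ = E ^ 4 := by ring
  have hA : (q : ℝ) * (E * dIn) + 1 ≤ E ^ 3 := by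
    calc (q : ℝ) * (E * dIn) + 1 ≤ E * (E * dIn) + E * E := by
          gcongr
          exact one_le_mul_of_one_le_of_one_le hE1 hE1
      _ = E * E * (dIn + 1) := by ring
      _ ≤ E * E * E := by gcongr
      _ = E ^ 3 := by ring
  calc _ ≤ Real.exp (-(q : ℝ) ^ 4) * (E * E * ((E ^ 4) ^ q * E ^ 3)) := by
        gcongr
        linarith
    _ = Real.exp (-(q : ℝ) ^ 4 + (4 * q + 5) * q) := by
        have : E * E * ((E ^ 4) ^ q * E ^ 3) = E ^ (4 * q + 5) := by ring
        rw [this, hpow, ← Real.exp_add]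
        push_cast
        rfl
    _ ≤ Real.exp (-q) := by
        gcongr
        nlinarith [mul_nonneg (by linarith : (0:ℝ) ≤ q - 4) (by positivity : (0:ℝ) ≤ (q:ℝ)^3),
          mul_nonneg (by linarith : (0:ℝ) ≤ q - 4) (by positivity : (0:ℝ) ≤ (q:ℝ)^2),
          mul_nonneg (by linarith : (0:ℝ) ≤ q - 4) (by positivity : (0:ℝ) ≤ (q:ℝ))]

/-- The number of cells of parameter space is far below `2 ^ (q ^ 8)`. -/
lemma eventually_cells_lt : ∀ᶠ q : ℕ in atTop,
    (q + 1) ^ 3 * (2 * ⌈Real.exp q / Real.exp (-(q : ℝ) ^ 4)⌉₊ + 1) ^ (2 * q) + 1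
      < 2 ^ (q ^ 8) := by
  filter_upwards [eventually_const_le_exp 5, eventually_ge_atTop 4] with q h5 hq4
  have hq : (4 : ℝ) ≤ q := by exact_mod_cast hq4
  set X : ℝ := q + q ^ 4 with hX
  have hdiv : Real.exp q / Real.exp (-(q : ℝ) ^ 4) = Real.exp X := by
    rw [← Real.exp_sub, sub_neg_eq_add]
  rw [hdiv]
  have hX1 : 1 ≤ Real.exp X := Real.one_le_exp (by positivity)
  have hK : 2 * (⌈Real.exp X⌉₊ : ℝ) + 1 ≤ Real.exp (q + X) := by
    have := (Nat.ceil_lt_add_one (Real.exp_pos X).le).le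
    rw [Real.exp_add _ X]
    nlinarith
  have hq1 : (q : ℝ) + 1 ≤ Real.exp q := Real.add_one_le_exp _
  have h1 : ((q + 1) ^ 3 * (2 * (⌈Real.exp X⌉₊ : ℝ) + 1) ^ (2 * q)) + 1 <
      Real.exp ((q : ℝ) ^ 8 / 2) := by
    calc ((q : ℝ) + 1) ^ 3 * (2 * (⌈Real.exp X⌉₊ : ℝ) + 1) ^ (2 * q) + 1
        ≤ Real.exp q ^ 3 * Real.exp (q + X) ^ (2 * q) + 1 := by gcongr
      _ = Real.exp (3 * q + 2 * q * (q + X)) + 1 := by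
          rw [← Real.exp_nat_mul, ← Real.exp_nat_mul, ← Real.exp_add]
          push_cast
          rfl
      _ < Real.exp (3 * q + 2 * q * (q + X) + 1) := by
          rw [Real.exp_add _ 1]
          have h2 := Real.add_one_lt_exp (x := 1) one_ne_zero
          have h3 : 1 ≤ Real.exp (3 * q + 2 * q * (q + X)) := Real.one_le_exp (by positivity)
          nlinarith
      _ ≤ Real.exp ((q : ℝ) ^ 8 / 2) := by
          gcongr
          have e1 : (64 : ℝ) ≤ q ^ 3 := by
            calc (64 : ℝ) = 4 ^ 3 := by norm_num
              _ ≤ _ := by gcongr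
          have e2 : (q : ℝ) ≤ q ^ 5 := le_self_pow₀ (by linarith) (by norm_num)
          have e3 : (q : ℝ) ^ 2 ≤ q ^ 5 := pow_le_pow_right₀ (by linarith) (by norm_num)
          have e4 : (64 : ℝ) * (q : ℝ) ^ 5 ≤ (q : ℝ) ^ 8 := by
            calc (64 : ℝ) * (q : ℝ) ^ 5 ≤ (q : ℝ) ^ 3 * (q : ℝ) ^ 5 := by gcongr
              _ = (q : ℝ) ^ 8 := by ring
          rw [hX]
          ring_nf
          linarith
  have h2 : Real.exp ((q : ℝ) ^ 8 / 2) ≤ 2 ^ (q ^ 8) := by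
    rw [← Real.rpow_natCast 2, Real.rpow_def_of_pos two_pos]
    gcongr
    push_cast
    nlinarith [Real.log_two_gt_d9, (by positivity : (0:ℝ) ≤ (q:ℝ)^8)]
  exact_mod_cast h1.trans_le h2

/-- For large `q`, among `2 ^ (q ^ 8) - 1` networks with at most `q` parameters, bounded by
`exp q`, two are `exp (-q)`-close on the unit ball of `L²`. -/
lemma eventually_exists_ne_abs_eval_sub_le {d dIn : ℕ} (hd : 1 ≤ d) {σ : ℝ → ℝ} {c : ℝ≥0}
    (hσ : LipschitzWith c σ) : ∀ᶠ q : ℕ in atTop,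
      ∀ (T : Type) [Fintype T] (Φ : T → Network d dIn), 2 ^ (q ^ 8) ≤ Fintype.card T + 1 →
        (∀ t, (Φ t).numParams ≤ q) → (∀ t, (Φ t).ParamsLE (Real.exp q)) →
        ∃ t t', t ≠ t' ∧ ∀ u : L2 d dIn, ‖u‖ ≤ 1 →
          |(Φ t).eval σ u - (Φ t').eval σ u| ≤ Real.exp (-q) := by
  filter_upwards [eventually_perturbation_le dIn |σ 0| c (abs_nonneg _) c.2,
    eventually_cells_lt] with q h1 h2 T _ Φ hT hnum hΦ
  obtain ⟨t, t', hne, h⟩ := exists_ne_abs_eval_sub_le hd hσ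
    (Real.one_le_exp (Nat.cast_nonneg q)) (Real.exp_pos (-(q : ℝ) ^ 4)) (Nat.le_ceil _)
    (by omega) hnum hΦ
  exact ⟨t, t', hne, fun u hu => (h u hu).trans h1⟩

/-! ### Separated families of Lipschitz functions -/

lemma convex_Lip1 (D : Type*) [PseudoMetricSpace D] : Convex ℝ (Lip1 D) := by
  intro G hG H hH a b ha hb hab
  refine ⟨fun u => ?_, LipschitzWith.of_dist_le_mul fun u v => ?_⟩
  · calc |a * G u + b * H u| ≤ a * |G u| + b * |H u| := by
          refine (abs_add_le _ _).trans_eq ?_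
          rw [abs_mul, abs_mul, abs_of_nonneg ha, abs_of_nonneg hb]
      _ ≤ a * 1 + b * 1 := by gcongr; exacts [hG.1 u, hH.1 u]
      _ = 1 := by linarith
  · have h1 := hG.2.dist_le_mul u v
    have h2 := hH.2.dist_le_mul u v
    simp only [Real.dist_eq, NNReal.coe_one, one_mul] at h1 h2 ⊢
    calc |a * G u + b * H u - (a * G v + b * H v)| = |a * (G u - G v) + b * (H u - H v)| := by
          congr 1; ring
      _ ≤ a * |G u - G v| + b * |H u - H v| := by
          refine (abs_add_le _ _).trans_eq ?_
          rw [abs_mul, abs_mul, abs_of_nonneg ha, abs_of_nonneg hb]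
      _ ≤ a * dist u v + b * dist u v := by gcongr
      _ = dist u v := by rw [← add_mul, hab, one_mul]

/-- The truncated distance functions to the nonempty subsets of a `δ`-separated set of `M` points
are `2 ^ M - 1` mutually `δ`-separated elements of `Lip₁`. -/
lemma exists_separated_family_Lip1 {D : Type*} [PseudoMetricSpace D] {M : ℕ} {δ : ℝ} (hδ : δ ≤ 1)
    {x : Fin M → D} (hx : ∀ i j, i ≠ j → δ ≤ dist (x i) (x j)) :
    ∃ f : {S : Finset (Fin M) // S ≠ ∅} → D →ᵇ ℝ, (∀ S, f S ∈ Lip1 D) ∧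
      ∀ S S', S ≠ S' → ∃ u, δ ≤ |f S u - f S' u| := by
  have hlip : ∀ A : Set D, LipschitzWith 1 fun u => min 1 (Metric.infDist u A) := fun A =>
    (Metric.lipschitz_infDist_pt A).const_min 1
  have hb : ∀ (A : Set D) u, |min 1 (Metric.infDist u A)| ≤ 1 := fun A u => by
    rw [abs_of_nonneg (le_min zero_le_one Metric.infDist_nonneg)]
    exact min_le_left _ _
  let f : {S : Finset (Fin M) // S ≠ ∅} → D →ᵇ ℝ := fun S =>
    BoundedContinuousFunction.ofNormedAddCommGroup
      (fun u => min 1 (Metric.infDist u (x '' S.1))) (hlip _).continuous 1 (hb _)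
  have hsep : ∀ S S' : {S : Finset (Fin M) // S ≠ ∅}, ∀ i ∈ S.1, i ∉ S'.1 →
      δ ≤ |f S (x i) - f S' (x i)| := fun S S' i hi hi' => by
    have h0 : Metric.infDist (x i) (x '' S.1) = 0 :=
      Metric.infDist_zero_of_mem (Set.mem_image_of_mem x hi)
    have h1 : δ ≤ Metric.infDist (x i) (x '' S'.1) := by
      refine (Metric.le_infDist ?_).2 ?_
      · exact (Finset.coe_nonempty.2 (Finset.nonempty_iff_ne_empty.2 S'.2)).image x
      · rintro _ ⟨j, hj, rfl⟩
        exact hx i j fun h => hi' (h ▸ hj)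
    change δ ≤ |min 1 (Metric.infDist (x i) (x '' S.1)) -
      min 1 (Metric.infDist (x i) (x '' S'.1))|
    rw [h0, abs_sub_comm, min_eq_right zero_le_one, sub_zero]
    exact (le_min hδ h1).trans (le_abs_self _)
  refine ⟨f, fun S => ⟨hb _, hlip _⟩, fun S S' hne => ?_⟩
  by_cases h : S.1 ⊆ S'.1
  · have h' : ¬ S'.1 ⊆ S.1 := fun h' => hne (Subtype.ext (h.antisymm h'))
    obtain ⟨i, hi, hi'⟩ := Finset.not_subset.1 h'
    exact ⟨x i, abs_sub_comm (f S' (x i)) _ ▸ hsep S' S i hi hi'⟩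
  · obtain ⟨i, hi, hi'⟩ := Finset.not_subset.1 h
    exact ⟨x i, hsep S S' i hi hi'⟩

/-! ### Nowhere density -/

/-- The operators in `Lip₁(K)` which, for every `q ≥ q₀`, are approximated to accuracy
`C (log q) ^ (-γ)` by a network with at most `q` parameters, bounded by `exp q`. -/
def approxSet {d dIn : ℕ} (σ : ℝ → ℝ) (K : Set (L2 d dIn)) (γ C : ℝ) (q₀ : ℕ) : Set (Lip1 K) :=
  {G | ∀ q : ℕ, q₀ ≤ q → ∃ Φ : Network d dIn, Φ.numParams ≤ q ∧ Φ.ParamsLE (Real.exp q) ∧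
    ∀ u : K, |G.1 u - Φ.eval σ u| ≤ C * (Real.log q) ^ (-γ)}

/-- With `log q ~ p ^ d`, the rate `(log q) ^ (-γ)` beats `p ^ (-s)` as soon as `γ > s / d`. -/
lemma eventually_rate_le {d : ℕ} {s γ : ℝ} (hd : 1 ≤ d) (hγ : s / d < γ) (C : ℝ) {a : ℝ}
    (ha : 0 < a) : ∀ᶠ p : ℕ in atTop,
      C * (Real.log ((2 ^ p ^ d : ℕ) : ℝ)) ^ (-γ) ≤ a * (p : ℝ) ^ (-s) := by
  have hd0 : (0 : ℝ) < d := by exact_mod_cast hd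
  have hpos : 0 < d * γ - s := by
    rw [div_lt_iff₀ hd0] at hγ
    linarith
  have h : Tendsto (fun p : ℕ => C * (Real.log 2) ^ (-γ) * (p : ℝ) ^ (-(d * γ - s))) atTop
      (𝓝 (C * (Real.log 2) ^ (-γ) * 0)) :=
    ((tendsto_rpow_neg_atTop hpos).comp tendsto_natCast_atTop_atTop).const_mul _
  rw [mul_zero] at h
  filter_upwards [h.eventually_le_const ha, eventually_ge_atTop 1] with p hp hp1
  have hp0 : (0 : ℝ) < p := by exact_mod_cast hp1
  have hlog : 0 < Real.log 2 := Real.log_pos one_lt_two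
  push_cast
  rw [Real.log_pow, Nat.cast_pow, Real.mul_rpow (by positivity) hlog.le,
    ← Real.rpow_natCast_mul hp0.le]
  calc C * ((p : ℝ) ^ (d * -γ) * Real.log 2 ^ (-γ))
      = C * Real.log 2 ^ (-γ) * (p : ℝ) ^ (-(d * γ - s)) * (p : ℝ) ^ (-s) := by
        rw [mul_assoc _ ((p : ℝ) ^ _), ← Real.rpow_add hp0]
        ring_nf
    _ ≤ a * (p : ℝ) ^ (-s) := by gcongr

lemma eventually_exp_neg_le (s : ℝ) {a : ℝ} (ha : 0 < a) :
    ∀ᶠ p : ℕ in atTop, Real.exp (-p) ≤ a * (p : ℝ) ^ (-s) := by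
  have h := ((isLittleO_exp_neg_mul_rpow_atTop one_pos (-s)).comp_tendsto
    tendsto_natCast_atTop_atTop).bound ha
  filter_upwards [h] with p hp
  simp only [Function.comp_apply, neg_mul, one_mul, Real.norm_eq_abs, Real.abs_exp] at hp
  rwa [abs_of_nonneg (by positivity)] at hp

/-- A neighbourhood of `G₀` in `Lip₁(K)` contains `2 ^ (2 ^ (N ^ d)) - 1` operators
`(1 - t) G₀ + t f_S` with mutual distance a multiple of `N ^ (-s)`. With `N = 8 p` and
`q = 2 ^ (p ^ d)`, there are more of them than networks of size `q`, up to small errors. -/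
lemma isNowhereDense_approxSet {d dIn : ℕ} (hd : 1 ≤ d) (hdIn : 1 ≤ dIn) {s : ℝ} (hs : 0 ≤ s)
    {σ : ℝ → ℝ} {c : ℝ≥0} (hσ : LipschitzWith c σ) {γ : ℝ} (hγ : s / d < γ) (C : ℝ) (q₀ : ℕ) :
    IsNowhereDense (approxSet σ (sobolevBall d dIn s) γ C q₀) := by
  rw [IsNowhereDense, Set.eq_empty_iff_forall_notMem]
  intro G₀ hG₀
  obtain ⟨r, hr, hball⟩ := Metric.mem_nhds_iff.1 (mem_interior_iff_mem_nhds.1 hG₀)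
  obtain ⟨b, hb0, hb1, hpack⟩ := exists_packing_sobolevBall hd hdIn hs
  set t : ℝ := min 1 (r / 4) with ht
  have ht0 : 0 < t := lt_min one_pos (by linarith)
  have ht1 : t ≤ 1 := min_le_left _ _
  have htr : 2 * t < r := by linarith [min_le_right 1 (r / 4)]
  have ha : 0 < t * (b * 8 ^ (-s)) / 8 := by positivity
  have hpq : Tendsto (fun p : ℕ => 2 ^ p ^ d) atTop atTop :=
    tendsto_atTop_mono (fun p => (Nat.le_self_pow (by omega) p).trans Nat.lt_two_pow_self.le)
      tendsto_id
  obtain ⟨p, hrate, hexp, hcount, hpq₀, hp1⟩ := ((eventually_rate_le hd hγ C ha).and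
    ((eventually_exp_neg_le s ha).and
      ((hpq.eventually (eventually_exists_ne_abs_eval_sub_le (dIn := dIn) hd hσ)).and
        ((hpq.eventually_ge_atTop q₀).and (eventually_ge_atTop 1))))).exists
  set q : ℕ := 2 ^ p ^ d with hq
  obtain ⟨x, hx⟩ := hpack (8 * p) (by omega)
  set δ : ℝ := b * ((8 * p : ℕ) : ℝ) ^ (-s) with hδ
  have hδ0 : 0 < δ := by
    have : (0 : ℝ) < ((8 * p : ℕ) : ℝ) := by exact_mod_cast (by omega : 0 < 8 * p)
    positivity
  have hδ1 : δ ≤ 1 := by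
    refine mul_le_one₀ hb1 (by positivity) (Real.rpow_le_one_of_one_le_of_nonpos ?_ (by linarith))
    exact_mod_cast (by omega : 1 ≤ 8 * p)
  have haδ : t * (b * 8 ^ (-s)) / 8 * (p : ℝ) ^ (-s) = t * δ / 8 := by
    rw [hδ, Nat.cast_mul, Real.mul_rpow (by positivity) (by positivity)]
    push_cast
    ring
  rw [haδ] at hrate hexp
  obtain ⟨f, hf, hsep⟩ := exists_separated_family_Lip1 hδ1 hx
  -- The convex combinations of `G₀` and `f S`; each is close to an element of the
  -- set, hence to a network.
  have hnet : ∀ S, ∃ Φ : Network d dIn, Φ.numParams ≤ q ∧ Φ.ParamsLE (Real.exp q) ∧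
      ∀ u : sobolevBall d dIn s, |((1 - t) * G₀.1 u + t * f S u) - Φ.eval σ u| ≤ t * δ / 4 := by
    intro S
    let G : Lip1 (sobolevBall d dIn s) := ⟨(1 - t) • G₀.1 + t • f S,
      convex_Lip1 _ G₀.2 (hf S) (by linarith) ht0.le (by ring)⟩
    have hG : G ∈ Metric.ball G₀ r := by
      rw [Metric.mem_ball, Subtype.dist_eq]
      refine lt_of_le_of_lt ?_ htr
      rw [BoundedContinuousFunction.dist_le (by positivity)]
      intro u
      have e : ((1 - t) * G₀.1 u + t * f S u) - G₀.1 u = t * (f S u - G₀.1 u) := by ring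
      change |((1 - t) * G₀.1 u + t * f S u) - G₀.1 u| ≤ 2 * t
      rw [e, abs_mul, abs_of_pos ht0, mul_comm]
      gcongr
      have h1 := (hf S).1 u
      have h2 := G₀.2.1 u
      exact (abs_sub _ _).trans (by linarith)
    obtain ⟨H, hH, hGH⟩ := Metric.mem_closure_iff.1 (hball hG) (t * δ / 8) (by positivity)
    obtain ⟨Φ, h1, h2, h3⟩ := hH q hpq₀
    refine ⟨Φ, h1, h2, fun u => ?_⟩
    have h4 : |((1 - t) * G₀.1 u + t * f S u) - H.1 u| ≤ t * δ / 8 :=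
      (BoundedContinuousFunction.dist_coe_le_dist u).trans hGH.le
    have h5 := (h3 u).trans hrate
    linarith [abs_sub_le ((1 - t) * G₀.1 u + t * f S u) (H.1 u) (Φ.eval σ u)]
  choose Φ hnum hpar happ using hnet
  have hcard : 2 ^ (q ^ 8) ≤ Fintype.card {S : Finset (Fin (2 ^ (8 * p) ^ d)) // S ≠ ∅} + 1 := by
    have h1 : Fintype.card {S : Finset (Fin (2 ^ (8 * p) ^ d)) // S ≠ ∅} + 1 =
        2 ^ 2 ^ (8 * p) ^ d := by
      rw [Fintype.card_subtype_compl, Fintype.card_finset, Fintype.card_fin,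
        Fintype.card_subtype_eq, Nat.sub_add_cancel Nat.one_le_two_pow]
    rw [h1]
    refine Nat.pow_le_pow_right two_pos ?_
    rw [hq, ← pow_mul]
    refine Nat.pow_le_pow_right two_pos ?_
    rw [mul_pow, mul_comm]
    exact Nat.mul_le_mul_right _ (Nat.le_self_pow (by omega) 8)
  obtain ⟨S, S', hne, hclose⟩ := hcount _ Φ hcard hnum hpar
  obtain ⟨u, hu⟩ := hsep S S' hne
  have h1 := happ S u
  have h2 := happ S' u
  have h3 := hclose u (norm_le_one_of_mem_sobolevBall hs u.2)
  have h4 : Real.exp (-(q : ℝ)) ≤ t * δ / 8 := by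
    refine le_trans (Real.exp_le_exp.2 (neg_le_neg ?_)) hexp
    exact_mod_cast (Nat.le_self_pow (by omega) p).trans Nat.lt_two_pow_self.le
  have h5 : t * δ ≤ |((1 - t) * G₀.1 u + t * f S u) - ((1 - t) * G₀.1 u + t * f S' u)| := by
    rw [add_sub_add_left_eq_sub, ← mul_sub, abs_mul, abs_of_pos ht0]
    gcongr
  have h6 : 0 < t * δ := by positivity
  -- The distance of the two perturbations is at most `2 (t δ / 4) + t δ / 8 < t δ`.
  rw [abs_le] at h1 h2 h3
  rcases le_abs'.1 h5 with h | h <;> linarith [h1.1, h1.2, h2.1, h2.2, h3.1, h3.2]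

/-- The rate `γ` and the constant may be replaced by members of countable families, at the cost of
discarding the `q` with `log q < 1`. -/
lemma ApproxAtLogRate.exists_mem_approxSet {d dIn : ℕ} {σ : ℝ → ℝ} {K : Set (L2 d dIn)}
    {G : Lip1 K} {γ : ℝ} (h : ApproxAtLogRate σ (fun u => G.1 u) γ) {γ' : ℝ} (hγ : γ' ≤ γ) :
    ∃ m q₀ : ℕ, G ∈ approxSet σ K γ' m q₀ := by
  obtain ⟨Φ, C, h⟩ := h
  obtain ⟨m, hm⟩ := exists_nat_ge C
  obtain ⟨q₀, hq₀⟩ := eventually_atTop.1 (h.and (eventually_ge_atTop 3))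
  refine ⟨m, q₀, fun q hq => ?_⟩
  obtain ⟨⟨h1, h2, h3⟩, hq3⟩ := hq₀ q hq
  have hlog : 1 ≤ Real.log q := by
    rw [Real.le_log_iff_exp_le (by positivity)]
    have : (3 : ℝ) ≤ q := by exact_mod_cast hq3
    linarith [Real.exp_one_lt_d9]
  refine ⟨Φ q, h1, h2, fun u => (h3 u).trans ?_⟩
  gcongr

end FNO

end

theorem mainTheorem10 (d dIn : ℕ) (hd : 1 ≤ d) (hdIn : 1 ≤ dIn) (s : ℝ) (hs : 0 < s)
    (σ : ℝ → ℝ) (hσ : ∃ c : ℝ≥0, LipschitzWith c σ) :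
    ∀ᶠ G : FNO.Lip1 (FNO.sobolevBall d dIn s) in residual (FNO.Lip1 (FNO.sobolevBall d dIn s)),
      ∀ γ : ℝ, s / d < γ → ¬ FNO.ApproxAtLogRate σ (fun u => G.1 u) γ := by
  obtain ⟨c, hc⟩ := hσ
  have h : ∀ᶠ G : FNO.Lip1 (FNO.sobolevBall d dIn s) in
      residual (FNO.Lip1 (FNO.sobolevBall d dIn s)), ∀ n m q₀ : ℕ,
        G ∉ FNO.approxSet σ (FNO.sobolevBall d dIn s) (s / d + 1 / (n + 1)) m q₀ := by
    simp only [eventually_countable_forall]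
    intro n m q₀
    exact (FNO.isNowhereDense_approxSet hd hdIn hs.le hc
      (lt_add_of_pos_right _ Nat.one_div_pos_of_nat) m q₀).isMeagre
  filter_upwards [h] with G hG γ hγ happ
  obtain ⟨n, hn⟩ := exists_nat_one_div_lt (sub_pos.2 hγ)
  obtain ⟨m, q₀, hmem⟩ := happ.exists_mem_approxSet (γ' := s / d + 1 / (n + 1)) (by linarith)
  exact hG n m q₀ hmem
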